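/- Let $(M,g)$ be a smooth $n$-dimensional Riemannian manifold with Levi-Civita connection $\nabla$, let $k\ge 2$, and let $\mathcal D_1,\dots,\mathcal D_k$ be pairwise orthogonal smooth distributions on $M$ of ranks $n_1,\dots,n_k$ with $\sum_i n_i=n$ (a Riemannian almost $k$-product manifold). The curvature tensor is $R(X,Y)Z=\nabla_Y\nabla_XZ-\nabla_X\nabla_YZ+\nabla_{[X,Y]}Z$, so that $\langle R(X,Y)X,Y\rangle$ is the sectional curvature of the plane spanned by orthonormal $X,Y$. The mixed scalar curvature is \[ S_{\rm mix}(\mathcal D_1,\dots,\mathcal D_k)=\sum_{i<j}\ \sum_{a,b}\ \langle R(E_a,E_b)E_a,E_b\rangle , \] where, for each $i<j$, $E_a$ and $E_b$ run through orthonormal bases of $\mathcal D_i$ and $\mathcal D_j$, respectively. For a set of indices $q\subseteq\{1,\dots,k\}$ let $\mathcal D_q=\bigoplus_{i\in q}\mathcal D_i$, let $\widehat P_q$ be the orthogonal projection of $TM$ onto $\mathcal D_q^\perp$, and for sections $X,Y$ of $\mathcal D_q$ let \[ h_q(X,Y)=\tfrac12\widehat P_q(\nabla_XY+\nabla_YX),\qquad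 T_q(X,Y)=\tfrac12\widehat P_q(\nabla_XY-\nabla_YX) \] be the second fundamental form and the integrability tensor of $\mathcal D_q$, and let $H_q=\sum_a h_q(E_a,E_a)$ be its mean curvature vector field, with $\|h_q\|^2=\sum_{a,b}\|h_q(E_a,E_b)\|^2$ and $\|T_q\|^2=\sum_{a,b}\|T_q(E_a,E_b)\|^2$, where $E_a, E_b$ run through an orthonormal basis of $\mathcal D_q$. Let $S(r,k)$ be the set of all $r$-element subsets of $\{1,\dots,k\}$. Then the vector field \[ X=\sum_{q\in S(1,k)}H_q+\sum_{q\in S(k-1,k)}H_q \] is smooth, and \[ \operatorname{div}X=2\,S_{\rm mix}(\mathcal D_1,\dots,\mathcal D_k)+\sum_{q\in S(1,k)}\big(\|h_q\|^2-\|H_q\|^2-\|T_q\|^2\big)+\sum_{q\in S(k-1,k)}\big(\|h_q\|^2-\|H_q\|^2-\|T_q\|^2\big). \] (For $k=2$ the two sums on either side coincide, and the formula is twice the formula $\operatorname{div}(H_1+H_2)=S_{\rm mix}+\sum_{i=1}^{2}(\|h_i\|^2-\|H_i\|^2-\|T_i\|^2)$.) -/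

import Mathlib

open scoped Manifold ContDiff Bundle InnerProductSpace
open Bundle

namespace AlmostProduct

noncomputable section

variable {E : Type*} [NormedAddCommGroup E] [NormedSpace ℝ E]
  {M : Type*} [TopologicalSpace M] [ChartedSpace E M]
  [RiemannianBundle (fun x : M => TangentSpace 𝓘(ℝ, E) x)]

/-- The right-hand side of Koszul's formula, divided by two: the value of `⟨∇_X Y, Z⟩` at `x`. -/
def koszul (X Y Z : Π x : M, TangentSpace 𝓘(ℝ, E) x) (x : M) : ℝ :=
  (1 / 2 : ℝ) *
    (mvfderiv 𝓘(ℝ, E) (fun y => ⟪Y y, Z y⟫_ℝ) x (X x)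
      + mvfderiv 𝓘(ℝ, E) (fun y => ⟪X y, Z y⟫_ℝ) x (Y x)
      - mvfderiv 𝓘(ℝ, E) (fun y => ⟪X y, Y y⟫_ℝ) x (Z x)
      + ⟪VectorField.mlieBracket 𝓘(ℝ, E) X Y x, Z x⟫_ℝ
      - ⟪VectorField.mlieBracket 𝓘(ℝ, E) X Z x, Y x⟫_ℝ
      - ⟪VectorField.mlieBracket 𝓘(ℝ, E) Y Z x, X x⟫_ℝ)

section
variable [IsManifold 𝓘(ℝ, E) ∞ M] {x : M}

theorem ext_extend {A B : TangentSpace 𝓘(ℝ, E) x →L[ℝ] TangentSpace 𝓘(ℝ, E) x}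
    (h : ∀ X Z : Π x : M, TangentSpace 𝓘(ℝ, E) x, MDiffAt (T% X) x → MDiffAt (T% Z) x →
      ⟪A (X x), Z x⟫_ℝ = ⟪B (X x), Z x⟫_ℝ) : A = B := by
  ext v
  refine ext_inner_right ℝ fun w => ?_
  simpa using h (FiberBundle.extend E v) (FiberBundle.extend E w)
    (FiberBundle.mdifferentiableAt_extend ..) (FiberBundle.mdifferentiableAt_extend ..)

variable
  [IsContMDiffRiemannianBundle 𝓘(ℝ, E) ∞ E (fun x : M => TangentSpace 𝓘(ℝ, E) x)]
  {X Y Z : Π x : M, TangentSpace 𝓘(ℝ, E) x}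


theorem mdifferentiableAt_inner (hX : MDiffAt (T% X) x) (hY : MDiffAt (T% Y) x) :
    MDiffAt (fun y => ⟪X y, Y y⟫_ℝ) x :=
  MDifferentiableAt.inner_bundle (IB := 𝓘(ℝ, E)) (F := E)
    (E := fun x : M => TangentSpace 𝓘(ℝ, E) x) (b := fun y => y) hX hY

variable [FiniteDimensional ℝ E]

instance finiteDimensional_tangentSpace : FiniteDimensional ℝ (TangentSpace 𝓘(ℝ, E) x) :=
  inferInstanceAs (FiniteDimensional ℝ E)
theorem tensorial_koszul_left (hY : MDiffAt (T% Y) x) (hZ : MDiffAt (T% Z) x) :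
    TensorialAt 𝓘(ℝ, E) E (koszul · Y Z x) x where
  smul {f X} hf hX := by
    have h1 := mdifferentiableAt_inner hX hZ
    have h2 := mdifferentiableAt_inner hX hY
    simp [koszul, mvfderiv_fun_mul hf h1, mvfderiv_fun_mul hf h2, inner_add_left, inner_smul_left,
      inner_smul_right,
      VectorField.mlieBracket_smul_left hf hX]
    ring
  add {X X'} hX hX' := by
    simp [koszul, mvfderiv_fun_add (mdifferentiableAt_inner hX hZ) (mdifferentiableAt_inner hX' hZ),
      mvfderiv_fun_add (mdifferentiableAt_inner hX hY) (mdifferentiableAt_inner hX' hY), inner_add_left, inner_add_right,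
      VectorField.mlieBracket_add_left hX hX']
    ring

theorem tensorial_koszul_right (hX : MDiffAt (T% X) x) (hY : MDiffAt (T% Y) x) :
    TensorialAt 𝓘(ℝ, E) E (koszul X Y · x) x where
  smul {f Z} hf hZ := by
    have h1 := mdifferentiableAt_inner hX hZ
    have h2 := mdifferentiableAt_inner hY hZ
    simp [koszul, mvfderiv_fun_mul hf h1, mvfderiv_fun_mul hf h2, inner_add_left, inner_smul_left,
      inner_smul_right,
      VectorField.mlieBracket_smul_right hf hZ, real_inner_comm]
    ring
  add {Z Z'} hZ hZ' := by
    simp [koszul, mvfderiv_fun_add (mdifferentiableAt_inner hX hZ) (mdifferentiableAt_inner hX hZ'),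
      mvfderiv_fun_add (mdifferentiableAt_inner hY hZ) (mdifferentiableAt_inner hY hZ'), inner_add_left, inner_add_right,
      VectorField.mlieBracket_add_right hZ hZ']
    ring


open scoped Classical in
/-- The Levi-Civita connection as a function: for a vector field `Y` differentiable at `x`,
`v ↦ ∇_v Y` is the endomorphism of the tangent space at `x` determined by Koszul's formula.
(Where `Y` is not differentiable, the value is set to `0`.) -/
def leviCivitaFun (Y : Π x : M, TangentSpace 𝓘(ℝ, E) x) (x : M) :
    TangentSpace 𝓘(ℝ, E) x →L[ℝ] TangentSpace 𝓘(ℝ, E) x :=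
  if hY : MDiffAt (T% Y) x then
    LinearMap.toContinuousLinearMap
      { toFun := fun v => (InnerProductSpace.toDual ℝ (TangentSpace 𝓘(ℝ, E) x)).symm
          (TensorialAt.mkHom₂ (fun X Z => koszul X Y Z x) x
            (fun _ hZ => tensorial_koszul_left hY hZ)
            (fun _ hX => tensorial_koszul_right hX hY) v)
        map_add' := fun v w => by simp
        map_smul' := fun c v => by simp }
  else 0

theorem inner_leviCivitaFun (hX : MDiffAt (T% X) x) (hY : MDiffAt (T% Y) x)
    (hZ : MDiffAt (T% Z) x) : ⟪leviCivitaFun Y x (X x), Z x⟫_ℝ = koszul X Y Z x := by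
  rw [leviCivitaFun, dif_pos hY]
  simp only [LinearMap.coe_toContinuousLinearMap', LinearMap.coe_mk, AddHom.coe_mk,
    InnerProductSpace.toDual_symm_apply]
  exact TensorialAt.mkHom₂_apply (Φ := fun X Z => koszul X Y Z x)
    (fun _ hZ => tensorial_koszul_left hY hZ) (fun _ hX => tensorial_koszul_right hX hY) hX hZ

variable (E M) in
/-- The Levi-Civita connection: `leviCivita E M Y x (X x)` is `(∇_X Y) x`. -/
def leviCivita : CovariantDerivative 𝓘(ℝ, E) E (fun x : M => TangentSpace 𝓘(ℝ, E) x) where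
  toFun := leviCivitaFun
  isCovariantDerivativeOnUniv :=
    { add := fun {Y Y' x} hY hY' _ => by
        refine ext_extend fun X Z hX hZ => ?_
        rw [inner_leviCivitaFun hX (mdifferentiableAt_add_section hY hY') hZ,
          _root_.add_apply, inner_add_left, inner_leviCivitaFun hX hY hZ,
          inner_leviCivitaFun hX hY' hZ]
        simp [koszul, mvfderiv_fun_add (mdifferentiableAt_inner hY hZ)
          (mdifferentiableAt_inner hY' hZ), mvfderiv_fun_add (mdifferentiableAt_inner hX hY)
          (mdifferentiableAt_inner hX hY'), inner_add_left, inner_add_right,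
          VectorField.mlieBracket_add_right hY hY', VectorField.mlieBracket_add_left hY hY']
        ring
      leibniz := fun {Y f x} hY hf _ => by
        refine ext_extend fun X Z hX hZ => ?_
        rw [inner_leviCivitaFun hX (hf.smul_section hY) hZ,
          _root_.add_apply, inner_add_left, _root_.smul_apply,
          inner_smul_left, inner_leviCivitaFun hX hY hZ]
        have h1 := mdifferentiableAt_inner hY hX
        have h2 := mdifferentiableAt_inner hY hZ
        simp [koszul, mvfderiv_fun_mul hf h1, mvfderiv_fun_mul hf h2, inner_add_left,
          inner_smul_left, inner_smul_right, VectorField.mlieBracket_smul_right hf hY,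
          VectorField.mlieBracket_smul_left hf hY, real_inner_comm]
        ring }

theorem leviCivita_torsion : (leviCivita E M).torsion = 0 := by
  rw [CovariantDerivative.torsion_eq_zero_iff]
  intro X Y x hX hY
  refine ext_inner_right ℝ fun w => ?_
  have hZ : MDiffAt (T% (FiberBundle.extend E w)) x :=
    FiberBundle.mdifferentiableAt_extend 𝓘(ℝ, E) E w
  have h1 := inner_leviCivitaFun hX hY hZ
  have h2 := inner_leviCivitaFun hY hX hZ
  rw [FiberBundle.extend_apply_self] at h1 h2
  rw [inner_sub_left]
  change ⟪leviCivitaFun Y x (X x), w⟫_ℝ - ⟪leviCivitaFun X x (Y x), w⟫_ℝ = _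
  rw [h1, h2]
  simp only [koszul, VectorField.mlieBracket_swap_apply (V := Y) (W := X), real_inner_comm,
    FiberBundle.extend_apply_self, inner_neg_left]
  ring

theorem leviCivita_metric {Z : Π x : M, TangentSpace 𝓘(ℝ, E) x} (hZ : MDiffAt (T% Z) x)
    (hX : MDiffAt (T% X) x) (hY : MDiffAt (T% Y) x) :
    mvfderiv 𝓘(ℝ, E) (fun y => ⟪X y, Y y⟫_ℝ) x (Z x) =
      ⟪leviCivita E M X x (Z x), Y x⟫_ℝ + ⟪X x, leviCivita E M Y x (Z x)⟫_ℝ := by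
  change _ = ⟪leviCivitaFun X x (Z x), Y x⟫_ℝ + ⟪X x, leviCivitaFun Y x (Z x)⟫_ℝ
  rw [real_inner_comm (leviCivitaFun Y x (Z x)), inner_leviCivitaFun hZ hX hY,
    inner_leviCivitaFun hZ hY hX]
  simp only [koszul, VectorField.mlieBracket_swap_apply (V := Y) (W := X), real_inner_comm,
    inner_neg_left]
  ring

/-- The divergence of a vector field: the trace of `v ↦ ∇_v X`. -/
def divergence (X : Π x : M, TangentSpace 𝓘(ℝ, E) x) (x : M) : ℝ :=
  LinearMap.trace ℝ (TangentSpace 𝓘(ℝ, E) x) (leviCivita E M X x).toLinearMap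

/-- The curvature tensor on vector fields, with the sign convention
`R(X, Y) Z = ∇_Y ∇_X Z - ∇_X ∇_Y Z + ∇_{[X, Y]} Z`, for which `⟨R(X, Y) X, Y⟩` is the sectional
curvature of the plane spanned by orthonormal `X`, `Y`. -/
def curvature (X Y Z : Π x : M, TangentSpace 𝓘(ℝ, E) x) (x : M) : TangentSpace 𝓘(ℝ, E) x :=
  leviCivita E M (fun y => leviCivita E M Z y (X y)) x (Y x)
    - leviCivita E M (fun y => leviCivita E M Z y (Y y)) x (X x)
    + leviCivita E M Z x (VectorField.mlieBracket 𝓘(ℝ, E) X Y x)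

/-- The curvature tensor on tangent vectors at `x`, through their local smooth extensions. -/
def curvatureAt (x : M) (u v w : TangentSpace 𝓘(ℝ, E) x) : TangentSpace 𝓘(ℝ, E) x :=
  curvature (FiberBundle.extend E u) (FiberBundle.extend E v) (FiberBundle.extend E w) x

variable (E M) in
/-- A field of subspaces of the tangent spaces. -/
abbrev Distribution := Π x : M, Submodule ℝ (TangentSpace 𝓘(ℝ, E) x)

/-- `D` is a smooth distribution of rank `n`: near every point it is spanned by `n` linearly
independent smooth vector fields. -/
def Distribution.IsSmoothOfRank (D : Distribution E M) (n : ℕ) : Prop :=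
  ∀ x₀ : M, ∃ U : Set M, IsOpen U ∧ x₀ ∈ U ∧
    ∃ s : Fin n → Π x : M, TangentSpace 𝓘(ℝ, E) x,
      (∀ a, CMDiff[U] ∞ (T% (s a))) ∧
      ∀ x ∈ U, LinearIndependent ℝ (fun a => s a x) ∧
        Submodule.span ℝ (Set.range fun a => s a x) = D x

/-- A local smooth section of `D` through the vector `v` (for `v ∈ D x`): the orthogonal projection
to `D` of a local smooth extension of `v`. -/
def Distribution.extendIn (D : Distribution E M) {x : M} (v : TangentSpace 𝓘(ℝ, E) x) :
    Π y : M, TangentSpace 𝓘(ℝ, E) y :=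
  fun y => (D y).starProjection (FiberBundle.extend E v y)

/-- The second fundamental form `½ P̂ (∇_X Y + ∇_Y X)` of `D`, for sections `X`, `Y` of `D`, where
`P̂` is the orthoprojector onto the orthogonal complement of `D`. -/
def Distribution.secondFundamentalForm (D : Distribution E M)
    (X Y : Π x : M, TangentSpace 𝓘(ℝ, E) x) (x : M) : TangentSpace 𝓘(ℝ, E) x :=
  (1 / 2 : ℝ) • (D x)ᗮ.starProjection (leviCivita E M Y x (X x) + leviCivita E M X x (Y x))

/-- The integrability tensor `½ P̂ (∇_X Y - ∇_Y X)` of `D`, for sections `X`, `Y` of `D`. -/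
def Distribution.integrabilityTensor (D : Distribution E M)
    (X Y : Π x : M, TangentSpace 𝓘(ℝ, E) x) (x : M) : TangentSpace 𝓘(ℝ, E) x :=
  (1 / 2 : ℝ) • (D x)ᗮ.starProjection (leviCivita E M Y x (X x) - leviCivita E M X x (Y x))

/-- The second fundamental form at `x` on vectors of `D x`. -/
def Distribution.h (D : Distribution E M) (x : M) (u v : D x) : TangentSpace 𝓘(ℝ, E) x :=
  D.secondFundamentalForm (D.extendIn (u : TangentSpace 𝓘(ℝ, E) x))
    (D.extendIn (v : TangentSpace 𝓘(ℝ, E) x)) x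

/-- The integrability tensor at `x` on vectors of `D x`. -/
def Distribution.T (D : Distribution E M) (x : M) (u v : D x) : TangentSpace 𝓘(ℝ, E) x :=
  D.integrabilityTensor (D.extendIn (u : TangentSpace 𝓘(ℝ, E) x))
    (D.extendIn (v : TangentSpace 𝓘(ℝ, E) x)) x

/-- The mean curvature vector `H = tr h` of `D` at `x`. -/
def Distribution.H (D : Distribution E M) (x : M) : TangentSpace 𝓘(ℝ, E) x :=
  ∑ a, D.h x (stdOrthonormalBasis ℝ (D x) a) (stdOrthonormalBasis ℝ (D x) a)

/-- `‖h‖²` at `x`. -/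
def Distribution.normSqh (D : Distribution E M) (x : M) : ℝ :=
  ∑ a, ∑ b, ‖D.h x (stdOrthonormalBasis ℝ (D x) a) (stdOrthonormalBasis ℝ (D x) b)‖ ^ 2

/-- `‖T‖²` at `x`. -/
def Distribution.normSqT (D : Distribution E M) (x : M) : ℝ :=
  ∑ a, ∑ b, ‖D.T x (stdOrthonormalBasis ℝ (D x) a) (stdOrthonormalBasis ℝ (D x) b)‖ ^ 2

/-- `K(D, D') = ∑ ⟨R(E_a, E_b) E_a, E_b⟩`, with `E_a`, `E_b` running through orthonormal bases of
`D` and `D'` at `x`. -/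
def mixedCurvature (D D' : Distribution E M) (x : M) : ℝ :=
  ∑ a, ∑ b, ⟪curvatureAt x (stdOrthonormalBasis ℝ (D x) a : TangentSpace 𝓘(ℝ, E) x)
      (stdOrthonormalBasis ℝ (D' x) b : TangentSpace 𝓘(ℝ, E) x)
      (stdOrthonormalBasis ℝ (D x) a : TangentSpace 𝓘(ℝ, E) x),
    (stdOrthonormalBasis ℝ (D' x) b : TangentSpace 𝓘(ℝ, E) x)⟫_ℝ

variable (E M) in
/-- A Riemannian almost `k`-product structure on `M`: pairwise orthogonal smooth distributions
`D 0, …, D (k - 1)` whose ranks add up to the dimension of `M`. -/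
structure RiemannianAlmostProduct (k : ℕ) where
  /-- the distributions -/
  D : Fin k → Distribution E M
  /-- their ranks -/
  rank : Fin k → ℕ
  isSmoothOfRank : ∀ i, (D i).IsSmoothOfRank (rank i)
  isOrtho : ∀ i j, i ≠ j → ∀ x, D i x ⟂ D j x
  sum_rank : ∑ i, rank i = Module.finrank ℝ E

/-- The mixed scalar curvature `∑_{i < j} K(D_i, D_j)`. -/
def RiemannianAlmostProduct.mixedScalarCurvature {k : ℕ} (P : RiemannianAlmostProduct E M k)
    (x : M) : ℝ :=
  ∑ i, ∑ j ∈ Finset.univ.filter (fun j => i < j), mixedCurvature (P.D i) (P.D j) x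

/-- The distribution `D_q = ⨁_{i ∈ q} D_i`. -/
def RiemannianAlmostProduct.sumOver {k : ℕ} (P : RiemannianAlmostProduct E M k)
    (q : Finset (Fin k)) : Distribution E M :=
  fun x => ⨆ i ∈ q, P.D i x

/-- `S(r, k)`: the set of all `r`-element subsets of the index set. -/
def combinations (r k : ℕ) : Finset (Finset (Fin k)) :=
  Finset.powersetCard r Finset.univ

end

end

end AlmostProduct

/-!
Fix a point and a smooth orthonormal frame `e` near it which is adapted to all the distributions:
each `D_i` is spanned by some of the `e_j`. Such a frame is obtained by applying the Gram-Schmidt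
process in each `D_i` separately (`RiemannianAlmostProduct.exists_frame`). Everything is then
expressed through the connection coefficients `Γ i j k = ⟨∇_{e_i} e_j, e_k⟩` (`connCoeff`), which
are smooth and skew-symmetric in `j`, `k`:

* if `D` is spanned by the `e_i` with `i ∈ s`, then `H = ∑_{k ∉ s} (∑_{i ∈ s} Γ i i k) e_k`, and
  `‖h‖²`, `‖T‖²` are sums of squares of the symmetric and skew-symmetric parts of `Γ i j k` for
  `i, j ∈ s`, `k ∉ s`;
* the sectional curvature of the plane of `e_a`, `e_b` is
  `e_b (Γ a a b) + e_a (Γ b b a)` plus an expression quadratic in `Γ`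
  (`IsOrthonormalFrameOn.inner_curvature_frame`);
* `div (∑ φ_k e_k) = ∑ e_k (φ_k) + ∑ φ_k Γ i k i`.

The derivative terms of `div H + div H'`, for `D` and its orthogonal complement `D'`, are those of
the sum of the curvatures over `D × D'`, and the quadratic terms are compared by a finite
computation that uses only the skew-symmetry of `Γ` (`divergence_algebra`). This gives Walczak's
formula for the pair `D`, `D'` (`IsOrthonormalFrameOn.divergence_H_add_divergence_H`). The theorem
is the sum of these formulas over `D = D_i`: the orthogonal complement of `D_i` is the sum of
the other distributions, and every pair `i ≠ j` occurs twice in the sum of the curvatures.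

Passing from the definitions, which use the local extensions of vectors and arbitrary orthonormal
bases, to the frame requires that the curvature, `h` and `T` are tensors. For `h` and `T` this holds
because `⟨∇_v Y, e_k⟩ = -⟨Y, ∇_v e_k⟩` for sections `Y` of `D` and normal `e_k`. The curvature is
tensorial in its first two arguments by the Leibniz rule, and in the third one by the
skew-symmetry `⟨R(X, Y) Z, W⟩ = -⟨R(X, Y) W, Z⟩`. The latter rests on
`X (Y f) - Y (X f) = [X, Y] f`, which is deduced from the Jacobi identity (`mvfderiv_mvfderiv_sub`).
-/

set_option linter.unusedSectionVars false

namespace AlmostProduct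

open scoped Topology
open FiberBundle VectorField InnerProductSpace

section LeviCivita

variable {E : Type*} [NormedAddCommGroup E] [NormedSpace ℝ E] [FiniteDimensional ℝ E]
  {M : Type*} [TopologicalSpace M] [ChartedSpace E M] [IsManifold 𝓘(ℝ, E) ∞ M]
  {X X' Y Y' Z Z' W : Π x : M, TangentSpace 𝓘(ℝ, E) x} {f : M → ℝ} {x : M}

/-! ### Derivatives of functions along vector fields -/

theorem mdifferentiableAt_of_contMDiffAt (hX : CMDiffAt ∞ (T% X) x) : MDiffAt (T% X) x :=
  hX.mdifferentiableAt (by simp)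

theorem eventually_mdifferentiableAt (hX : CMDiffAt ∞ (T% X) x) :
    ∀ᶠ y in 𝓝 x, MDiffAt (T% X) y := by
  have h := (contMDiffAt_iff_contMDiffAt_nhds (n := 1) (by simp)).1 (hX.of_le (by simp))
  filter_upwards [h] with y hy using hy.mdifferentiableAt (by simp)

theorem eventually_mdifferentiableAt_fun (hf : CMDiffAt ∞ f x) : ∀ᶠ y in 𝓝 x, MDiffAt f y := by
  have h := (contMDiffAt_iff_contMDiffAt_nhds (n := 1) (by simp)).1 (hf.of_le (by simp))
  filter_upwards [h] with y hy using hy.mdifferentiableAt (by simp)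

theorem contMDiffAt_extend_tangent (v : TangentSpace 𝓘(ℝ, E) x) :
    CMDiffAt ∞ (T% (extend E v)) x :=
  contMDiffAt_extend 𝓘(ℝ, E) E v

theorem isManifold_minSmoothness_three : IsManifold 𝓘(ℝ, E) (minSmoothness ℝ 3) M := by
  rw [minSmoothness_of_isRCLikeNormedField]
  infer_instance

theorem isManifold_minSmoothness_two : IsManifold 𝓘(ℝ, E) (minSmoothness ℝ 2) M := by
  rw [minSmoothness_of_isRCLikeNormedField]
  infer_instance

attribute [local instance] isManifold_minSmoothness_three isManifold_minSmoothness_two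

theorem minSmoothness_two_le_infty : minSmoothness ℝ 2 ≤ ∞ := by
  rw [minSmoothness_of_isRCLikeNormedField]
  exact ENat.LEInfty.out

theorem contMDiffAt_mlieBracket (hX : CMDiffAt ∞ (T% X) x) (hY : CMDiffAt ∞ (T% Y) x) :
    CMDiffAt ∞ (T% (mlieBracket 𝓘(ℝ, E) X Y)) x :=
  haveI : IsManifold 𝓘(ℝ, E) (((⊤ : ℕ∞) : ℕ∞ω) + 1) M := ‹IsManifold 𝓘(ℝ, E) ∞ M›
  ContMDiffAt.mlieBracket_vectorField (n := ⊤) (m := ⊤) hX hY (by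
    rw [minSmoothness_of_isRCLikeNormedField]; rfl)

variable (x) in
theorem exists_contMDiffAt_ne_zero [Nontrivial E] :
    ∃ Z : Π x : M, TangentSpace 𝓘(ℝ, E) x, CMDiffAt ∞ (T% Z) x ∧ Z x ≠ 0 := by
  obtain ⟨v, hv⟩ : ∃ v : TangentSpace 𝓘(ℝ, E) x, v ≠ 0 := exists_ne (α := E) 0
  exact ⟨extend E v, contMDiffAt_extend_tangent v, by simpa using hv⟩

theorem mvfderiv_congr {g : M → ℝ} (h : f =ᶠ[𝓝 x] g) :
    mvfderiv 𝓘(ℝ, E) f x = mvfderiv 𝓘(ℝ, E) g x := by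
  ext v
  exact congrArg (fun A : E →L[ℝ] ℝ => A v) (h.mfderiv_eq (I := 𝓘(ℝ, E)) (I' := 𝓘(ℝ, ℝ)))

variable [RiemannianBundle (fun x : M => TangentSpace 𝓘(ℝ, E) x)]
  [IsContMDiffRiemannianBundle 𝓘(ℝ, E) ∞ E (fun x : M => TangentSpace 𝓘(ℝ, E) x)]

theorem contMDiffAt_inner (hX : CMDiffAt ∞ (T% X) x) (hY : CMDiffAt ∞ (T% Y) x) :
    CMDiffAt ∞ (fun y => ⟪X y, Y y⟫_ℝ) x :=
  ContMDiffAt.inner_bundle (IB := 𝓘(ℝ, E)) (F := E)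
    (E := fun x : M => TangentSpace 𝓘(ℝ, E) x) (b := fun y => y) hX hY

/-- The derivative of a smooth function along a smooth field is smooth. Instead of coordinates, the
proof uses the identity `(X f) Z = [X, f Z] - f [X, Z]` for an auxiliary field `Z` without zeros
near `x`, all of whose other terms are known to be smooth. -/
theorem contMDiffAt_mvfderiv_apply (hf : CMDiffAt ∞ f x) (hX : CMDiffAt ∞ (T% X) x) :
    CMDiffAt ∞ (fun y => mvfderiv 𝓘(ℝ, E) f y (X y)) x := by
  rcases subsingleton_or_nontrivial E with hE | hE
  · have h0 : (fun y => mvfderiv 𝓘(ℝ, E) f y (X y)) = fun _ => 0 := by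
      funext y
      have : X y = 0 := Subsingleton.elim (α := E) _ _
      rw [this, map_zero]
    rw [h0]
    exact contMDiffAt_const
  obtain ⟨Z, hZ, hZx⟩ := exists_contMDiffAt_ne_zero (E := E) x
  have hZZ := contMDiffAt_inner hZ hZ
  replace hZx : ⟪Z x, Z x⟫_ℝ ≠ 0 := inner_self_ne_zero.2 hZx
  have hW : CMDiffAt ∞ (T% (mlieBracket 𝓘(ℝ, E) X (f • Z) - f • mlieBracket 𝓘(ℝ, E) X Z)) x :=
    (contMDiffAt_mlieBracket hX (hf.smul_section hZ)).sub_section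
      (hf.smul_section (contMDiffAt_mlieBracket hX hZ))
  refine ((contMDiffAt_inner hW hZ).div₀ hZZ hZx).congr_of_eventuallyEq ?_
  filter_upwards [eventually_mdifferentiableAt hZ, eventually_mdifferentiableAt_fun hf,
    hZZ.continuousAt.eventually_ne hZx] with y h1 h2 h3
  have h4 := mlieBracket_smul_right (V := X) h2 h1
  have h5 : (mlieBracket 𝓘(ℝ, E) X (f • Z) - f • mlieBracket 𝓘(ℝ, E) X Z) y =
      mvfderiv 𝓘(ℝ, E) f y (X y) • Z y := sub_eq_of_eq_add h4
  change _ = ⟪(mlieBracket 𝓘(ℝ, E) X (f • Z) - f • mlieBracket 𝓘(ℝ, E) X Z) y, Z y⟫_ℝ / ⟪Z y, Z y⟫_ℝ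
  rw [h5]
  erw [inner_smul_left]
  exact (mul_div_cancel_right₀ _ h3).symm

/-- Second derivatives commute up to the Lie bracket: `X (Y f) - Y (X f) = [X, Y] f`. This follows
by comparing the coefficients of `Z` in the Jacobi identity for `X`, `Y`, `f Z`. -/
theorem mvfderiv_mvfderiv_sub (hf : CMDiffAt ∞ f x) (hX : CMDiffAt ∞ (T% X) x)
    (hY : CMDiffAt ∞ (T% Y) x) :
    mvfderiv 𝓘(ℝ, E) (fun y => mvfderiv 𝓘(ℝ, E) f y (Y y)) x (X x)
      - mvfderiv 𝓘(ℝ, E) (fun y => mvfderiv 𝓘(ℝ, E) f y (X y)) x (Y x)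
      = mvfderiv 𝓘(ℝ, E) f x (mlieBracket 𝓘(ℝ, E) X Y x) := by
  rcases subsingleton_or_nontrivial E with hE | hE
  · have h0 (v : TangentSpace 𝓘(ℝ, E) x) : v = 0 := Subsingleton.elim (α := E) _ _
    rw [h0 (X x), h0 (Y x), h0 (mlieBracket 𝓘(ℝ, E) X Y x)]
    simp
  obtain ⟨Z, hZ, hZx⟩ := exists_contMDiffAt_ne_zero (E := E) x
  have key : ∀ {V : Π x : M, TangentSpace 𝓘(ℝ, E) x}, CMDiffAt ∞ (T% V) x →
      mlieBracket 𝓘(ℝ, E) V (f • Z) =ᶠ[𝓝 x]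
        (fun y => mvfderiv 𝓘(ℝ, E) f y (V y)) • Z + f • mlieBracket 𝓘(ℝ, E) V Z := by
    intro V hV
    filter_upwards [eventually_mdifferentiableAt hZ, eventually_mdifferentiableAt_fun hf]
      with y h1 h2
    exact mlieBracket_smul_right h2 h1
  have second : ∀ {V V' : Π x : M, TangentSpace 𝓘(ℝ, E) x}, CMDiffAt ∞ (T% V) x →
      CMDiffAt ∞ (T% V') x → mlieBracket 𝓘(ℝ, E) V (mlieBracket 𝓘(ℝ, E) V' (f • Z)) x =
        mvfderiv 𝓘(ℝ, E) (fun y => mvfderiv 𝓘(ℝ, E) f y (V' y)) x (V x) • Z x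
          + mvfderiv 𝓘(ℝ, E) f x (V' x) • mlieBracket 𝓘(ℝ, E) V Z x
          + mvfderiv 𝓘(ℝ, E) f x (V x) • mlieBracket 𝓘(ℝ, E) V' Z x
          + f x • mlieBracket 𝓘(ℝ, E) V (mlieBracket 𝓘(ℝ, E) V' Z) x := by
    intro V V' hV hV'
    have hd := contMDiffAt_mvfderiv_apply hf hV'
    have hb := contMDiffAt_mlieBracket hV' hZ
    rw [(Filter.EventuallyEq.refl _ V).mlieBracket_vectorField_eq (key hV'),
      mlieBracket_add_right (mdifferentiableAt_of_contMDiffAt (hd.smul_section hZ))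
        (mdifferentiableAt_of_contMDiffAt (hf.smul_section hb)),
      mlieBracket_smul_right (hd.mdifferentiableAt (by simp)) (mdifferentiableAt_of_contMDiffAt hZ),
      mlieBracket_smul_right (hf.mdifferentiableAt (by simp)) (mdifferentiableAt_of_contMDiffAt hb)]
    abel
  have J1 := leibniz_identity_mlieBracket_apply (hX.of_le minSmoothness_two_le_infty)
    (hY.of_le minSmoothness_two_le_infty) ((hf.smul_section hZ).of_le minSmoothness_two_le_infty)
  have J2 := leibniz_identity_mlieBracket_apply (hX.of_le minSmoothness_two_le_infty)
    (hY.of_le minSmoothness_two_le_infty) (hZ.of_le minSmoothness_two_le_infty)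
  rw [second hX hY, second hY hX, mlieBracket_smul_right (hf.mdifferentiableAt (by simp))
    (mdifferentiableAt_of_contMDiffAt hZ), J2] at J1
  rw [← sub_eq_zero]
  refine (smul_eq_zero.1 ?_).resolve_right hZx
  simp only [sub_smul]
  rw [← sub_eq_zero] at J1
  rw [← J1]
  module

end LeviCivita

section Curvature

variable {E : Type*} [NormedAddCommGroup E] [NormedSpace ℝ E] [FiniteDimensional ℝ E]
  {M : Type*} [TopologicalSpace M] [ChartedSpace E M] [IsManifold 𝓘(ℝ, E) ∞ M]
  [RiemannianBundle (fun x : M => TangentSpace 𝓘(ℝ, E) x)]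
  [IsContMDiffRiemannianBundle 𝓘(ℝ, E) ∞ E (fun x : M => TangentSpace 𝓘(ℝ, E) x)]
  {X X' Y Y' Z Z' W : Π x : M, TangentSpace 𝓘(ℝ, E) x} {f : M → ℝ} {x : M}
  {ι : Type*} {e : ι → Π x : M, TangentSpace 𝓘(ℝ, E) x} {U : Set M}

/-! ### Orthonormal frames -/

/-- A smooth orthonormal frame of the tangent bundle on the open set `U`. -/
structure IsOrthonormalFrameOn (e : ι → Π x : M, TangentSpace 𝓘(ℝ, E) x) (U : Set M) : Prop where
  isOpen : IsOpen U
  contMDiffAt : ∀ i, ∀ y ∈ U, CMDiffAt ∞ (T% (e i)) y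
  orthonormal : ∀ y ∈ U, Orthonormal ℝ (fun i => e i y)
  span_eq_top : ∀ y ∈ U, ⊤ ≤ Submodule.span ℝ (Set.range fun i => e i y)

namespace IsOrthonormalFrameOn

/-- The orthonormal basis of the tangent space at a point given by an orthonormal frame. -/
noncomputable def basis [Fintype ι] (he : IsOrthonormalFrameOn e U) (hx : x ∈ U) :
    OrthonormalBasis ι ℝ (TangentSpace 𝓘(ℝ, E) x) :=
  OrthonormalBasis.mk (he.orthonormal x hx) (he.span_eq_top x hx)

theorem basis_apply [Fintype ι] (he : IsOrthonormalFrameOn e U) (hx : x ∈ U) (i : ι) :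
    he.basis hx i = e i x := by
  simp [basis]

theorem sum_inner_smul [Fintype ι] (he : IsOrthonormalFrameOn e U) (hx : x ∈ U)
    (v : TangentSpace 𝓘(ℝ, E) x) : ∑ i, ⟪e i x, v⟫_ℝ • e i x = v := by
  simpa [basis_apply] using (he.basis hx).sum_repr' v

theorem sum_inner_mul_inner [Fintype ι] (he : IsOrthonormalFrameOn e U) (hx : x ∈ U)
    (v w : TangentSpace 𝓘(ℝ, E) x) : ∑ i, ⟪v, e i x⟫_ℝ * ⟪e i x, w⟫_ℝ = ⟪v, w⟫_ℝ := by
  simpa [basis_apply] using (he.basis hx).sum_inner_mul_inner v w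

theorem inner_eq [DecidableEq ι] (he : IsOrthonormalFrameOn e U) (hx : x ∈ U) (i j : ι) :
    ⟪e i x, e j x⟫_ℝ = if i = j then 1 else 0 :=
  orthonormal_iff_ite.1 (he.orthonormal x hx) i j

theorem eventually_mem (he : IsOrthonormalFrameOn e U) (hx : x ∈ U) : ∀ᶠ y in 𝓝 x, y ∈ U :=
  he.isOpen.mem_nhds hx

theorem mdifferentiableAt (he : IsOrthonormalFrameOn e U) (hx : x ∈ U) (i : ι) :
    MDiffAt (T% (e i)) x :=
  mdifferentiableAt_of_contMDiffAt (he.contMDiffAt i x hx)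

theorem eventuallyEq_sum [Fintype ι] (he : IsOrthonormalFrameOn e U) (hx : x ∈ U)
    (Y : Π x : M, TangentSpace 𝓘(ℝ, E) x) :
    (fun y => ∑ i, ⟪e i y, Y y⟫_ℝ • e i y) =ᶠ[𝓝 x] Y := by
  filter_upwards [he.eventually_mem hx] with y hy using he.sum_inner_smul hy (Y y)

theorem contMDiffAt_of_inner [Fintype ι] (he : IsOrthonormalFrameOn e U) (hx : x ∈ U)
    (h : ∀ i, CMDiffAt ∞ (fun y => ⟪e i y, Y y⟫_ℝ) x) : CMDiffAt ∞ (T% Y) x := by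
  have h1 : CMDiffAt ∞ (T% (fun y => ∑ i, ⟪e i y, Y y⟫_ℝ • e i y)) x :=
    .sum_section fun i _ => (h i).smul_section (he.contMDiffAt i x hx)
  refine h1.congr_of_eventuallyEq ?_
  filter_upwards [he.eventuallyEq_sum hx Y] with y hy using congrArg (TotalSpace.mk y) hy.symm

end IsOrthonormalFrameOn

/-! ### The Levi-Civita connection on smooth vector fields -/

theorem leviCivita_add (hX : MDiffAt (T% X) x) (hX' : MDiffAt (T% X') x) :
    leviCivita E M (X + X') x = leviCivita E M X x + leviCivita E M X' x :=
  (leviCivita E M).isCovariantDerivativeOnUniv.add hX hX'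

theorem leviCivita_smul_apply (hf : MDiffAt f x) (hX : MDiffAt (T% X) x)
    (v : TangentSpace 𝓘(ℝ, E) x) :
    leviCivita E M (f • X) x v =
      f x • leviCivita E M X x v + mvfderiv 𝓘(ℝ, E) f x v • X x := by
  have h := (leviCivita E M).isCovariantDerivativeOnUniv.leibniz hX hf
  exact congrArg (fun A => A v) h

theorem leviCivita_sub_leviCivita (hX : MDiffAt (T% X) x) (hY : MDiffAt (T% Y) x) :
    leviCivita E M Y x (X x) - leviCivita E M X x (Y x) = mlieBracket 𝓘(ℝ, E) X Y x :=
  (CovariantDerivative.torsion_eq_zero_iff _).1 leviCivita_torsion hX hY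

theorem contMDiffAt_koszul (hX : CMDiffAt ∞ (T% X) x) (hY : CMDiffAt ∞ (T% Y) x)
    (hZ : CMDiffAt ∞ (T% Z) x) : CMDiffAt ∞ (koszul X Y Z) x :=
  contMDiffAt_const.mul
    ((((((contMDiffAt_mvfderiv_apply (contMDiffAt_inner hY hZ) hX).add
      (contMDiffAt_mvfderiv_apply (contMDiffAt_inner hX hZ) hY)).sub
      (contMDiffAt_mvfderiv_apply (contMDiffAt_inner hX hY) hZ)).add
      (contMDiffAt_inner (contMDiffAt_mlieBracket hX hY) hZ)).sub
      (contMDiffAt_inner (contMDiffAt_mlieBracket hX hZ) hY)).sub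
      (contMDiffAt_inner (contMDiffAt_mlieBracket hY hZ) hX))

/-- If `X` and `Y` are smooth, then so is `∇_X Y`: its components in an orthonormal frame are given
by Koszul's formula. -/
theorem IsOrthonormalFrameOn.contMDiffAt_leviCivita [Fintype ι] (he : IsOrthonormalFrameOn e U)
    (hx : x ∈ U) (hX : CMDiffAt ∞ (T% X) x) (hY : CMDiffAt ∞ (T% Y) x) :
    CMDiffAt ∞ (T% (fun y => leviCivita E M Y y (X y))) x := by
  refine he.contMDiffAt_of_inner hx fun i => ?_
  refine (contMDiffAt_koszul hX hY (he.contMDiffAt i x hx)).congr_of_eventuallyEq ?_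
  filter_upwards [eventually_mdifferentiableAt hX, eventually_mdifferentiableAt hY,
    he.eventually_mem hx] with y h1 h2 h3
  rw [real_inner_comm]
  exact inner_leviCivitaFun h1 h2 (he.mdifferentiableAt h3 i)

/-- If `X` is only differentiable at `x`, but `Y` is smooth, then `∇_X Y` is differentiable. -/
theorem IsOrthonormalFrameOn.mdifferentiableAt_leviCivita [Fintype ι]
    (he : IsOrthonormalFrameOn e U) (hx : x ∈ U) (hX : MDiffAt (T% X) x)
    (hY : CMDiffAt ∞ (T% Y) x) : MDiffAt (T% (fun y => leviCivita E M Y y (X y))) x := by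
  have h1 : MDiffAt (T% (fun y => ∑ i, ⟪e i y, X y⟫_ℝ • leviCivita E M Y y (e i y))) x :=
    .sum_section fun i _ => (mdifferentiableAt_inner (he.mdifferentiableAt hx i) hX).smul_section
      (mdifferentiableAt_of_contMDiffAt (he.contMDiffAt_leviCivita hx (he.contMDiffAt i x hx) hY))
  refine h1.congr_of_eventuallyEq ?_
  filter_upwards [he.eventually_mem hx] with y hy
  have h2 : ∑ i, ⟪e i y, X y⟫_ℝ • leviCivita E M Y y (e i y) = leviCivita E M Y y (X y) := by
    conv_rhs => rw [← he.sum_inner_smul hy (X y)]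
    rw [map_sum]
    exact Finset.sum_congr rfl fun i _ => (map_smul (leviCivita E M Y y) _ _).symm
  rw [h2]

/-! ### Tensoriality of the curvature -/

theorem curvature_swap (X Y Z : Π x : M, TangentSpace 𝓘(ℝ, E) x) (x : M) :
    curvature X Y Z x = -curvature Y X Z x := by
  simp only [curvature, mlieBracket_swap_apply (V := X) (W := Y)]
  erw [map_neg]
  abel

theorem IsOrthonormalFrameOn.tensorial_curvature_left [Fintype ι] (he : IsOrthonormalFrameOn e U)
    (hx : x ∈ U) (hZ : CMDiffAt ∞ (T% Z) x) :
    TensorialAt 𝓘(ℝ, E) E (curvature · Y Z x) x where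
  smul {f X} hf hX := by
    have h1 : (fun y => leviCivita E M Z y ((f • X) y)) =
        f • fun y => leviCivita E M Z y (X y) := by
      funext y
      exact map_smul (leviCivita E M Z y) (f y) (X y)
    simp only [curvature]
    rw [h1, leviCivita_smul_apply hf (he.mdifferentiableAt_leviCivita hx hX hZ),
      mlieBracket_smul_left hf hX]
    have h2 : leviCivita E M (fun y => leviCivita E M Z y (Y y)) x ((f • X) x) =
      f x • leviCivita E M (fun y => leviCivita E M Z y (Y y)) x (X x) := map_smul _ (f x) (X x)
    have h3 (c d : ℝ) (v w : TangentSpace 𝓘(ℝ, E) x) : leviCivita E M Z x (-c • v + d • w) =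
        -c • leviCivita E M Z x v + d • leviCivita E M Z x w := by
      rw [map_add, map_smul, map_smul]
    erw [h2, h3]
    simp only [smul_add, smul_sub, neg_smul]
    abel
  add {X X'} hX hX' := by
    have h1 : (fun y => leviCivita E M Z y ((X + X') y)) =
        (fun y => leviCivita E M Z y (X y)) + fun y => leviCivita E M Z y (X' y) := by
      funext y
      exact map_add (leviCivita E M Z y) (X y) (X' y)
    simp only [curvature]
    rw [h1, leviCivita_add (he.mdifferentiableAt_leviCivita hx hX hZ)
      (he.mdifferentiableAt_leviCivita hx hX' hZ), mlieBracket_add_left hX hX']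
    have h2 : leviCivita E M (fun y => leviCivita E M Z y (Y y)) x ((X + X') x) =
      leviCivita E M (fun y => leviCivita E M Z y (Y y)) x (X x) +
      leviCivita E M (fun y => leviCivita E M Z y (Y y)) x (X' x) := map_add _ (X x) (X' x)
    have h3 (v w : TangentSpace 𝓘(ℝ, E) x) : leviCivita E M Z x (v + w) =
        leviCivita E M Z x v + leviCivita E M Z x w := map_add _ _ _
    erw [h2, h3, _root_.add_apply]
    abel

/-- The curvature is skew-symmetric in the last two arguments: differentiate `⟨Z, W⟩` twice and use
that second derivatives commute up to the bracket. -/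
theorem IsOrthonormalFrameOn.inner_curvature_swap [Fintype ι] (he : IsOrthonormalFrameOn e U)
    (hx : x ∈ U) (hX : CMDiffAt ∞ (T% X) x) (hY : CMDiffAt ∞ (T% Y) x)
    (hZ : CMDiffAt ∞ (T% Z) x) (hW : CMDiffAt ∞ (T% W) x) :
    ⟪curvature X Y Z x, W x⟫_ℝ = -⟪curvature X Y W x, Z x⟫_ℝ := by
  have first : ∀ {V : Π x : M, TangentSpace 𝓘(ℝ, E) x}, CMDiffAt ∞ (T% V) x →
      (fun y => mvfderiv 𝓘(ℝ, E) (fun z => ⟪Z z, W z⟫_ℝ) y (V y)) =ᶠ[𝓝 x]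
        fun y => ⟪leviCivita E M Z y (V y), W y⟫_ℝ + ⟪Z y, leviCivita E M W y (V y)⟫_ℝ := by
    intro V hV
    filter_upwards [eventually_mdifferentiableAt hV, eventually_mdifferentiableAt hZ,
      eventually_mdifferentiableAt hW] with y h1 h2 h3 using leviCivita_metric h1 h2 h3
  have second : ∀ {V V' : Π x : M, TangentSpace 𝓘(ℝ, E) x}, CMDiffAt ∞ (T% V) x →
      CMDiffAt ∞ (T% V') x →
      mvfderiv 𝓘(ℝ, E) (fun y => mvfderiv 𝓘(ℝ, E) (fun z => ⟪Z z, W z⟫_ℝ) y (V y)) x (V' x) =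
        ⟪leviCivita E M (fun y => leviCivita E M Z y (V y)) x (V' x), W x⟫_ℝ
          + ⟪leviCivita E M Z x (V x), leviCivita E M W x (V' x)⟫_ℝ
          + (⟪leviCivita E M Z x (V' x), leviCivita E M W x (V x)⟫_ℝ
          + ⟪Z x, leviCivita E M (fun y => leviCivita E M W y (V y)) x (V' x)⟫_ℝ) := by
    intro V V' hV hV'
    have h1 := mdifferentiableAt_of_contMDiffAt hV'
    have h2 := mdifferentiableAt_of_contMDiffAt hZ
    have h3 := mdifferentiableAt_of_contMDiffAt hW
    have h4 := mdifferentiableAt_of_contMDiffAt (he.contMDiffAt_leviCivita hx hV hZ)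
    have h5 := mdifferentiableAt_of_contMDiffAt (he.contMDiffAt_leviCivita hx hV hW)
    have h6 := congrArg (fun A => A (V' x)) (mvfderiv_congr (E := E) (first hV))
    refine h6.trans ?_
    rw [mvfderiv_fun_add (mdifferentiableAt_inner h4 h3) (mdifferentiableAt_inner h2 h5)]
    erw [_root_.add_apply]
    rw [leviCivita_metric h1 h4 h3, leviCivita_metric h1 h2 h5]
  have hc := mvfderiv_mvfderiv_sub (contMDiffAt_inner hZ hW) hX hY
  rw [second hX hY, second hY hX, leviCivita_metric (mdifferentiableAt_of_contMDiffAt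
    (contMDiffAt_mlieBracket hX hY)) (mdifferentiableAt_of_contMDiffAt hZ)
    (mdifferentiableAt_of_contMDiffAt hW)] at hc
  simp only [curvature, inner_add_left, inner_sub_left]
  rw [real_inner_comm _ (Z x), real_inner_comm _ (Z x), real_inner_comm _ (Z x)] at hc
  linarith

/-- The curvature at a point depends only on the values of the fields there. -/
theorem IsOrthonormalFrameOn.curvature_congr [Fintype ι] (he : IsOrthonormalFrameOn e U)
    (hx : x ∈ U) (hX : CMDiffAt ∞ (T% X) x) (hX' : CMDiffAt ∞ (T% X') x)
    (hY : CMDiffAt ∞ (T% Y) x) (hY' : CMDiffAt ∞ (T% Y') x)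
    (hZ : CMDiffAt ∞ (T% Z) x) (hZ' : CMDiffAt ∞ (T% Z') x)
    (hXX : X x = X' x) (hYY : Y x = Y' x) (hZZ : Z x = Z' x) :
    curvature X Y Z x = curvature X' Y' Z' x := by
  have left : ∀ {X X' Y : Π x : M, TangentSpace 𝓘(ℝ, E) x}, CMDiffAt ∞ (T% X) x →
      CMDiffAt ∞ (T% X') x → X x = X' x →
      curvature X Y Z x = curvature X' Y Z x := fun hX hX' h =>
    (he.tensorial_curvature_left hx hZ).pointwise
      (mdifferentiableAt_of_contMDiffAt hX) (mdifferentiableAt_of_contMDiffAt hX') h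
  rw [left hX hX' hXX, curvature_swap, left hY hY' hYY, ← curvature_swap]
  refine ext_inner_right ℝ fun w => ?_
  have hw := contMDiffAt_extend_tangent w
  have h1 := he.inner_curvature_swap hx hX' hY' hZ hw
  have h2 := he.inner_curvature_swap hx hX' hY' hZ' hw
  rw [hZZ, ← h2] at h1
  simpa using h1

end Curvature

/-! ### Orthonormal bases of subspaces -/

section LinearAlgebra

variable {V : Type*} [NormedAddCommGroup V] [InnerProductSpace ℝ V] {ι : Type*} {e : ι → V}

theorem starProjection_span_orthonormal [FiniteDimensional ℝ V] (he : Orthonormal ℝ e)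
    (s : Finset ι) (K : Submodule ℝ V) (hK : K = Submodule.span ℝ (e '' s)) (v : V) :
    K.starProjection v = ∑ i ∈ s, ⟪e i, v⟫_ℝ • e i := by
  classical
  refine Submodule.eq_starProjection_of_mem_of_inner_eq_zero ?_ fun w hw => ?_
  · rw [hK]
    exact Submodule.sum_mem _ fun i hi => Submodule.smul_mem _ _
      (Submodule.subset_span ⟨i, hi, rfl⟩)
  · rw [hK] at hw
    induction hw using Submodule.span_induction with
    | mem w hw =>
      obtain ⟨j, hj, rfl⟩ := hw
      have hj' : j ∈ s := hj
      simp [inner_sub_left, sum_inner, inner_smul_left, orthonormal_iff_ite.1 he, hj',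
        real_inner_comm]
    | zero => simp
    | add w w' _ _ h h' => rw [inner_add_right, h, h', add_zero]
    | smul c w _ h => rw [inner_smul_right, h, mul_zero]

theorem sum_bilin_orthonormalBasis [FiniteDimensional ℝ V] {F κ : Type*} [AddCommGroup F]
    [Module ℝ F] [Fintype κ] (he : Orthonormal ℝ e) (s : Finset ι) (K : Submodule ℝ V)
    (hK : K = Submodule.span ℝ (e '' s)) (b : OrthonormalBasis κ ℝ K) (β : V →ₗ[ℝ] V →ₗ[ℝ] F) :
    ∑ a, β (b a) (b a) = ∑ i ∈ s, β (e i) (e i) := by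
  classical
  have hmem : ∀ i ∈ s, e i ∈ K := fun i hi => hK ▸ Submodule.subset_span ⟨i, hi, rfl⟩
  have hb (a : κ) : ∑ i ∈ s, ⟪e i, (b a : V)⟫_ℝ • e i = b a := by
    rw [← starProjection_span_orthonormal he s K hK,
      Submodule.starProjection_eq_self_iff.2 (b a).2]
  have hsum : ∀ i ∈ s, ∀ j ∈ s, ∑ a, ⟪e i, (b a : V)⟫_ℝ * ⟪e j, (b a : V)⟫_ℝ =
      if i = j then 1 else 0 := by
    intro i hi j hj
    rw [← orthonormal_iff_ite.1 he i j]
    have := b.sum_inner_mul_inner ⟨e i, hmem i hi⟩ ⟨e j, hmem j hj⟩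
    simp only [Submodule.coe_inner] at this
    rw [← this]
    exact Finset.sum_congr rfl fun a _ => by rw [real_inner_comm (e j)]
  calc ∑ a, β (b a) (b a)
      = ∑ a, ∑ i ∈ s, ∑ j ∈ s, (⟪e i, (b a : V)⟫_ℝ * ⟪e j, (b a : V)⟫_ℝ) • β (e i) (e j) := by
        refine Finset.sum_congr rfl fun a _ => ?_
        conv_lhs => rw [← hb a]
        simp only [map_sum, map_smul, LinearMap.sum_apply, LinearMap.smul_apply, Finset.smul_sum,
          smul_smul]
        rw [Finset.sum_comm]
        exact Finset.sum_congr rfl fun i _ => Finset.sum_congr rfl fun j _ => by rw [mul_comm]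
    _ = ∑ i ∈ s, ∑ j ∈ s, (∑ a, ⟪e i, (b a : V)⟫_ℝ * ⟪e j, (b a : V)⟫_ℝ) • β (e i) (e j) := by
        rw [Finset.sum_comm]
        refine Finset.sum_congr rfl fun i _ => ?_
        rw [Finset.sum_comm]
        exact Finset.sum_congr rfl fun j _ => by rw [Finset.sum_smul]
    _ = ∑ i ∈ s, β (e i) (e i) := by
        refine Finset.sum_congr rfl fun i hi => ?_
        rw [Finset.sum_congr rfl fun j hj => by rw [hsum i hi j hj]]
        simp [hi]

theorem sum_norm_sq_orthonormalBasis [FiniteDimensional ℝ V] {κ : Type*} [Fintype κ]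
    (he : Orthonormal ℝ e) (s : Finset ι) (K : Submodule ℝ V)
    (hK : K = Submodule.span ℝ (e '' s)) (b : OrthonormalBasis κ ℝ K) (S : V →ₗ[ℝ] V →ₗ[ℝ] V) :
    ∑ a, ∑ c, ‖S (b a) (b c)‖ ^ 2 = ∑ i ∈ s, ∑ j ∈ s, ‖S (e i) (e j)‖ ^ 2 := by
  have h1 (a : κ) : ∑ c, ‖S (b a) (b c)‖ ^ 2 = ∑ j ∈ s, ‖S (b a) (e j)‖ ^ 2 := by
    simpa using sum_bilin_orthonormalBasis he s K hK b
      ((innerₗ V).compl₁₂ (S (b a)) (S (b a)))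
  have h2 (j : ι) : ∑ a, ‖S (b a) (e j)‖ ^ 2 = ∑ i ∈ s, ‖S (e i) (e j)‖ ^ 2 := by
    simpa using sum_bilin_orthonormalBasis he s K hK b
      ((innerₗ V).compl₁₂ (S.flip (e j)) (S.flip (e j)))
  simp only [h1]
  rw [Finset.sum_comm, Finset.sum_comm (s := s) (t := s)]
  exact Finset.sum_congr rfl fun j _ => h2 j

end LinearAlgebra

section Frame

variable {E : Type*} [NormedAddCommGroup E] [NormedSpace ℝ E] [FiniteDimensional ℝ E]
  {M : Type*} [TopologicalSpace M] [ChartedSpace E M] [IsManifold 𝓘(ℝ, E) ∞ M]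
  [RiemannianBundle (fun x : M => TangentSpace 𝓘(ℝ, E) x)]
  [IsContMDiffRiemannianBundle 𝓘(ℝ, E) ∞ E (fun x : M => TangentSpace 𝓘(ℝ, E) x)]
  {X Y : Π x : M, TangentSpace 𝓘(ℝ, E) x} {x : M}
  {ι : Type*} [Fintype ι] {e : ι → Π x : M, TangentSpace 𝓘(ℝ, E) x} {U : Set M}

/-! ### Connection coefficients, curvature and divergence in an orthonormal frame -/

/-- The connection coefficient `⟨∇_{e_i} e_j, e_k⟩` of a frame `e`. -/
noncomputable def connCoeff (e : ι → Π x : M, TangentSpace 𝓘(ℝ, E) x) (i j k : ι) (x : M) : ℝ :=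
  ⟪leviCivita E M (e j) x (e i x), e k x⟫_ℝ

namespace IsOrthonormalFrameOn

theorem contMDiffAt_connCoeff (he : IsOrthonormalFrameOn e U) (hx : x ∈ U) (i j k : ι) :
    CMDiffAt ∞ (connCoeff e i j k) x :=
  contMDiffAt_inner (he.contMDiffAt_leviCivita hx (he.contMDiffAt i x hx) (he.contMDiffAt j x hx))
    (he.contMDiffAt k x hx)

theorem connCoeff_swap (he : IsOrthonormalFrameOn e U) (hx : x ∈ U) (i j k : ι) :
    connCoeff e i j k x = -connCoeff e i k j x := by
  classical
  have h := leviCivita_metric (he.mdifferentiableAt hx i) (he.mdifferentiableAt hx j)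
    (he.mdifferentiableAt hx k)
  have h1 : (fun y => ⟪e j y, e k y⟫_ℝ) =ᶠ[𝓝 x] fun _ => if j = k then 1 else 0 := by
    filter_upwards [he.eventually_mem hx] with y hy using he.inner_eq hy j k
  rw [mvfderiv_congr h1, mvfderiv_const, real_inner_comm _ (e j x)] at h
  exact eq_neg_of_add_eq_zero_left h.symm

theorem inner_leviCivita_leviCivita_frame (he : IsOrthonormalFrameOn e U) (hx : x ∈ U)
    (i j k l : ι) :
    ⟪leviCivita E M (e j) x (e i x), leviCivita E M (e l) x (e k x)⟫_ℝ =
      ∑ c, connCoeff e i j c x * connCoeff e k l c x := by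
  rw [← he.sum_inner_mul_inner hx]
  exact Finset.sum_congr rfl fun c _ => by
    rw [connCoeff, connCoeff, real_inner_comm _ (e c x)]

theorem inner_leviCivita_apply (he : IsOrthonormalFrameOn e U) (hx : x ∈ U)
    (v : TangentSpace 𝓘(ℝ, E) x) (w : TangentSpace 𝓘(ℝ, E) x) :
    ⟪leviCivita E M Y x v, w⟫_ℝ = ∑ i, ⟪e i x, v⟫_ℝ * ⟪leviCivita E M Y x (e i x), w⟫_ℝ := by
  have h2 : leviCivita E M Y x v = ∑ i, ⟪e i x, v⟫_ℝ • leviCivita E M Y x (e i x) := by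
    conv_lhs => rw [← he.sum_inner_smul hx v]
    rw [map_sum]
    exact Finset.sum_congr rfl fun i _ => map_smul (leviCivita E M Y x) _ _
  rw [h2, sum_inner]
  exact Finset.sum_congr rfl fun i _ => by rw [inner_smul_left]; rfl

theorem inner_leviCivita_leviCivita (he : IsOrthonormalFrameOn e U) (hx : x ∈ U)
    (i j k l : ι) :
    ⟪leviCivita E M (fun y => leviCivita E M (e j) y (e i y)) x (e l x), e k x⟫_ℝ =
      mvfderiv 𝓘(ℝ, E) (connCoeff e i j k) x (e l x)
        - ∑ c, connCoeff e i j c x * connCoeff e l k c x := by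
  rw [← he.inner_leviCivita_leviCivita_frame hx, eq_sub_iff_add_eq]
  exact (leviCivita_metric (he.mdifferentiableAt hx l) (mdifferentiableAt_of_contMDiffAt
    (he.contMDiffAt_leviCivita hx (he.contMDiffAt i x hx) (he.contMDiffAt j x hx)))
    (he.mdifferentiableAt hx k)).symm

/-- The sectional curvature of the plane spanned by two vectors of the frame, in terms of the
connection coefficients. -/
theorem inner_curvature_frame (he : IsOrthonormalFrameOn e U) (hx : x ∈ U) (a b : ι) :
    ⟪curvature (e a) (e b) (e a) x, e b x⟫_ℝ =
      mvfderiv 𝓘(ℝ, E) (connCoeff e a a b) x (e b x)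
        + mvfderiv 𝓘(ℝ, E) (connCoeff e b b a) x (e a x)
        + ∑ c, (-(connCoeff e a a c x * connCoeff e b b c x)
          + connCoeff e b a c x * connCoeff e a b c x
          + (connCoeff e a b c x - connCoeff e b a c x) * connCoeff e c a b x) := by
  have h1 : connCoeff e b a b =ᶠ[𝓝 x] fun y => -connCoeff e b b a y := by
    filter_upwards [he.eventually_mem hx] with y hy using he.connCoeff_swap hy b a b
  have h2 : mvfderiv 𝓘(ℝ, E) (connCoeff e b a b) x (e a x) =
      -mvfderiv 𝓘(ℝ, E) (connCoeff e b b a) x (e a x) := by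
    rw [mvfderiv_congr h1, mvfderiv_fun_neg]
    rfl
  rw [curvature, inner_add_left, inner_sub_left, he.inner_leviCivita_leviCivita hx,
    he.inner_leviCivita_leviCivita hx, h2, he.inner_leviCivita_apply hx (mlieBracket _ _ _ x),
    ← leviCivita_sub_leviCivita (he.mdifferentiableAt hx a) (he.mdifferentiableAt hx b)]
  simp only [Finset.sum_add_distrib, Finset.sum_neg_distrib]
  have h3 : ∑ i, ⟪e i x, leviCivita E M (e b) x (e a x) - leviCivita E M (e a) x (e b x)⟫_ℝ *
      ⟪leviCivita E M (e a) x (e i x), e b x⟫_ℝ =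
      ∑ c, (connCoeff e a b c x - connCoeff e b a c x) * connCoeff e c a b x :=
    Finset.sum_congr rfl fun c _ => by
      rw [inner_sub_right, connCoeff, connCoeff, connCoeff, real_inner_comm (e c x),
        real_inner_comm (e c x)]
  rw [h3]
  ring

theorem divergence_eq_sum (he : IsOrthonormalFrameOn e U) (hx : x ∈ U) :
    divergence X x = ∑ i, ⟪leviCivita E M X x (e i x), e i x⟫_ℝ := by
  rw [divergence, LinearMap.trace_eq_sum_inner _ (he.basis hx)]
  exact Finset.sum_congr rfl fun i _ => by rw [he.basis_apply hx, real_inner_comm]; rfl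

/-- The divergence in an orthonormal frame, for a field whose components near `x` are `φ`. -/
theorem divergence_eq (he : IsOrthonormalFrameOn e U) (hx : x ∈ U) {φ : ι → M → ℝ}
    (hX : CMDiffAt ∞ (T% X) x) (h : ∀ k, (fun y => ⟪X y, e k y⟫_ℝ) =ᶠ[𝓝 x] φ k) :
    divergence X x = ∑ k, (mvfderiv 𝓘(ℝ, E) (φ k) x (e k x)
      + φ k x * ∑ i, connCoeff e i k i x) := by
  have h1 (k : ι) : ⟪leviCivita E M X x (e k x), e k x⟫_ℝ =
      mvfderiv 𝓘(ℝ, E) (φ k) x (e k x) - ∑ i, φ i x * connCoeff e k k i x := by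
    have hm := leviCivita_metric (he.mdifferentiableAt hx k) (mdifferentiableAt_of_contMDiffAt hX)
      (he.mdifferentiableAt hx k)
    rw [← mvfderiv_congr (h k), hm, ← he.sum_inner_mul_inner hx (X x)]
    have h2 : ∑ i, ⟪X x, e i x⟫_ℝ * ⟪e i x, leviCivita E M (e k) x (e k x)⟫_ℝ =
        ∑ i, φ i x * connCoeff e k k i x := Finset.sum_congr rfl fun i _ => by
      rw [connCoeff, real_inner_comm _ (e i x), ← (h i).self_of_nhds]
    rw [h2]
    ring
  rw [he.divergence_eq_sum hx]
  simp only [h1, Finset.sum_add_distrib, Finset.sum_sub_distrib, Finset.mul_sum]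
  rw [sub_eq_add_neg, ← Finset.sum_neg_distrib, Finset.sum_comm]
  congr 1
  simp only [← Finset.sum_neg_distrib]
  exact Finset.sum_congr rfl fun k _ => Finset.sum_congr rfl fun i _ => by
    rw [he.connCoeff_swap hx k k i]; ring

end IsOrthonormalFrameOn

/-! ### Linearity of the curvature tensor in its arguments -/

namespace IsOrthonormalFrameOn

theorem curvatureAt_apply (he : IsOrthonormalFrameOn e U) (hx : x ∈ U)
    {X Y Z : Π x : M, TangentSpace 𝓘(ℝ, E) x} (hX : CMDiffAt ∞ (T% X) x)
    (hY : CMDiffAt ∞ (T% Y) x) (hZ : CMDiffAt ∞ (T% Z) x) :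
    curvatureAt x (X x) (Y x) (Z x) = curvature X Y Z x :=
  he.curvature_congr hx (contMDiffAt_extend_tangent _) hX (contMDiffAt_extend_tangent _) hY
    (contMDiffAt_extend_tangent _) hZ (by simp) (by simp) (by simp)

theorem curvatureAt_swap (u v w : TangentSpace 𝓘(ℝ, E) x) :
    curvatureAt x u v w = -curvatureAt x v u w :=
  curvature_swap _ _ _ _

theorem inner_curvatureAt_swap (he : IsOrthonormalFrameOn e U) (hx : x ∈ U)
    (u v w z : TangentSpace 𝓘(ℝ, E) x) :
    ⟪curvatureAt x u v w, z⟫_ℝ = -⟪curvatureAt x u v z, w⟫_ℝ := by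
  simpa [curvatureAt] using he.inner_curvature_swap hx (contMDiffAt_extend_tangent u)
    (contMDiffAt_extend_tangent v) (contMDiffAt_extend_tangent w) (contMDiffAt_extend_tangent z)

theorem curvatureAt_add_left (he : IsOrthonormalFrameOn e U) (hx : x ∈ U)
    (u u' v w : TangentSpace 𝓘(ℝ, E) x) :
    curvatureAt x (u + u') v w = curvatureAt x u v w + curvatureAt x u' v w := by
  have hu := contMDiffAt_extend_tangent u
  have hu' := contMDiffAt_extend_tangent u'
  have h := (he.tensorial_curvature_left (Y := extend E v) hx (contMDiffAt_extend_tangent w)).add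
    (mdifferentiableAt_of_contMDiffAt hu) (mdifferentiableAt_of_contMDiffAt hu')
  refine Eq.trans ?_ h
  exact he.curvature_congr hx (contMDiffAt_extend_tangent _) (hu.add_section hu')
    (contMDiffAt_extend_tangent _) (contMDiffAt_extend_tangent _) (contMDiffAt_extend_tangent _)
    (contMDiffAt_extend_tangent _) (by simp) rfl rfl

theorem curvatureAt_smul_left (he : IsOrthonormalFrameOn e U) (hx : x ∈ U) (c : ℝ)
    (u v w : TangentSpace 𝓘(ℝ, E) x) :
    curvatureAt x (c • u) v w = c • curvatureAt x u v w := by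
  have hu := contMDiffAt_extend_tangent u
  have hc : CMDiffAt ∞ (fun _ : M => c) x := contMDiffAt_const
  have h := (he.tensorial_curvature_left (Y := extend E v) hx (contMDiffAt_extend_tangent w)).smul
    (hc.mdifferentiableAt (by simp)) (mdifferentiableAt_of_contMDiffAt hu)
  refine Eq.trans ?_ h
  exact he.curvature_congr hx (contMDiffAt_extend_tangent _) (hc.smul_section hu)
    (contMDiffAt_extend_tangent _) (contMDiffAt_extend_tangent _) (contMDiffAt_extend_tangent _)
    (contMDiffAt_extend_tangent _) (by simp) rfl rfl

theorem curvatureAt_add_middle (he : IsOrthonormalFrameOn e U) (hx : x ∈ U)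
    (u v v' w : TangentSpace 𝓘(ℝ, E) x) :
    curvatureAt x u (v + v') w = curvatureAt x u v w + curvatureAt x u v' w := by
  rw [curvatureAt_swap, he.curvatureAt_add_left hx, curvatureAt_swap v, curvatureAt_swap v']
  abel

theorem curvatureAt_smul_middle (he : IsOrthonormalFrameOn e U) (hx : x ∈ U) (c : ℝ)
    (u v w : TangentSpace 𝓘(ℝ, E) x) :
    curvatureAt x u (c • v) w = c • curvatureAt x u v w := by
  rw [curvatureAt_swap, he.curvatureAt_smul_left hx, curvatureAt_swap v, smul_neg, neg_neg]

/-- `(u, w) ↦ ⟨R(u, v) w, v⟩` as a bilinear form. -/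
noncomputable def curvatureFormLeft (he : IsOrthonormalFrameOn e U) (hx : x ∈ U)
    (v : TangentSpace 𝓘(ℝ, E) x) :
    TangentSpace 𝓘(ℝ, E) x →ₗ[ℝ] TangentSpace 𝓘(ℝ, E) x →ₗ[ℝ] ℝ :=
  LinearMap.mk₂ ℝ (fun u w => ⟪curvatureAt x u v w, v⟫_ℝ)
    (fun u u' w => by rw [he.curvatureAt_add_left hx, inner_add_left])
    (fun c u w => by rw [he.curvatureAt_smul_left hx, inner_smul_left]; rfl)
    (fun u w w' => by
      rw [he.inner_curvatureAt_swap hx, inner_add_right, he.inner_curvatureAt_swap hx _ _ w,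
        he.inner_curvatureAt_swap hx _ _ w']
      ring)
    (fun c u w => by
      rw [he.inner_curvatureAt_swap hx, inner_smul_right, he.inner_curvatureAt_swap hx _ _ w]
      simp)

/-- `(v, z) ↦ ⟨R(u, v) u, z⟩` as a bilinear form. -/
noncomputable def curvatureFormRight (he : IsOrthonormalFrameOn e U) (hx : x ∈ U)
    (u : TangentSpace 𝓘(ℝ, E) x) :
    TangentSpace 𝓘(ℝ, E) x →ₗ[ℝ] TangentSpace 𝓘(ℝ, E) x →ₗ[ℝ] ℝ :=
  LinearMap.mk₂ ℝ (fun v z => ⟪curvatureAt x u v u, z⟫_ℝ)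
    (fun v v' z => by rw [he.curvatureAt_add_middle hx, inner_add_left])
    (fun c v z => by rw [he.curvatureAt_smul_middle hx, inner_smul_left]; rfl)
    (fun v z z' => inner_add_right _ _ _)
    (fun c v z => inner_smul_right _ _ _)

end IsOrthonormalFrameOn

end Frame

section Distribution

variable {E : Type*} [NormedAddCommGroup E] [NormedSpace ℝ E] [FiniteDimensional ℝ E]
  {M : Type*} [TopologicalSpace M] [ChartedSpace E M] [IsManifold 𝓘(ℝ, E) ∞ M]
  [RiemannianBundle (fun x : M => TangentSpace 𝓘(ℝ, E) x)]
  [IsContMDiffRiemannianBundle 𝓘(ℝ, E) ∞ E (fun x : M => TangentSpace 𝓘(ℝ, E) x)]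
  {X Y : Π x : M, TangentSpace 𝓘(ℝ, E) x} {x : M}
  {ι : Type*} [Fintype ι] [DecidableEq ι] {e : ι → Π x : M, TangentSpace 𝓘(ℝ, E) x} {U : Set M}
  {D D' : Distribution E M} {s t : Finset ι}

/-! ### The extrinsic geometry of a distribution in an adapted frame -/

/-- On `U`, the distribution `D` is spanned by the fields `e i` with `i ∈ s`. -/
def Distribution.IsSpannedOn (D : Distribution E M) (e : ι → Π x : M, TangentSpace 𝓘(ℝ, E) x)
    (s : Finset ι) (U : Set M) : Prop :=
  ∀ y ∈ U, D y = Submodule.span ℝ ((fun i => e i y) '' s)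

namespace IsOrthonormalFrameOn

theorem starProjection_eq (he : IsOrthonormalFrameOn e U) (hD : D.IsSpannedOn e s U) (hx : x ∈ U)
    (v : TangentSpace 𝓘(ℝ, E) x) : (D x).starProjection v = ∑ i ∈ s, ⟪e i x, v⟫_ℝ • e i x :=
  starProjection_span_orthonormal (he.orthonormal x hx) s (D x) (hD x hx) v

theorem starProjection_orthogonal_eq (he : IsOrthonormalFrameOn e U) (hD : D.IsSpannedOn e s U)
    (hx : x ∈ U) (v : TangentSpace 𝓘(ℝ, E) x) :
    (D x)ᗮ.starProjection v = ∑ i ∈ sᶜ, ⟪e i x, v⟫_ℝ • e i x := by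
  have h := Submodule.starProjection_add_starProjection_orthogonal (K := D x) v
  have h2 := he.sum_inner_smul hx v
  rw [← Finset.sum_add_sum_compl s] at h2
  rw [he.starProjection_eq hD hx] at h
  exact add_left_cancel (h.trans h2.symm)

theorem inner_eq_zero_of_mem (he : IsOrthonormalFrameOn e U) (hD : D.IsSpannedOn e s U)
    (hx : x ∈ U) {v : TangentSpace 𝓘(ℝ, E) x} (hv : v ∈ D x) {k : ι} (hk : k ∈ sᶜ) :
    ⟪v, e k x⟫_ℝ = 0 := by
  rw [← Submodule.starProjection_eq_self_iff.2 hv, he.starProjection_eq hD hx, sum_inner]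
  refine Finset.sum_eq_zero fun i hi => ?_
  have hik : i ≠ k := fun h => Finset.mem_compl.1 hk (h ▸ hi)
  rw [inner_smul_left, he.inner_eq hx, if_neg hik, mul_zero]

/-- The bilinear map `(u, v) ↦ P̂ ∇_u v`, which is well defined for sections `v` of the distribution
spanned by the `e i` with `i ∈ s`; here `P̂` is the projection to the span of the other `e i`. -/
noncomputable def normalForm (e : ι → Π x : M, TangentSpace 𝓘(ℝ, E) x) (s : Finset ι) (x : M) :
    TangentSpace 𝓘(ℝ, E) x →ₗ[ℝ] TangentSpace 𝓘(ℝ, E) x →ₗ[ℝ] TangentSpace 𝓘(ℝ, E) x :=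
  ∑ k ∈ sᶜ, ∑ i, ∑ j, connCoeff e i j k x •
    (LinearMap.mk₂ ℝ (fun u v => (⟪e i x, u⟫_ℝ * ⟪e j x, v⟫_ℝ) • e k x)
      (fun u u' v => by rw [inner_add_right, add_mul, add_smul])
      (fun c u v => by rw [inner_smul_right, mul_assoc, mul_smul])
      (fun u v v' => by rw [inner_add_right, mul_add, add_smul])
      (fun c u v => by rw [inner_smul_right, mul_left_comm, mul_smul]))

theorem normalForm_apply (u v : TangentSpace 𝓘(ℝ, E) x) :
    normalForm e s x u v = ∑ k ∈ sᶜ,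
      (∑ i, ∑ j, connCoeff e i j k x * (⟪e i x, u⟫_ℝ * ⟪e j x, v⟫_ℝ)) • e k x := by
  simp [normalForm, LinearMap.sum_apply, Finset.sum_smul, smul_smul]

theorem normalForm_frame (he : IsOrthonormalFrameOn e U) (hx : x ∈ U) (i j : ι) :
    normalForm e s x (e i x) (e j x) = ∑ k ∈ sᶜ, connCoeff e i j k x • e k x := by
  simp [normalForm_apply, he.inner_eq hx]

/-- For a section `Y` of `D`, the normal part of `∇_v Y` depends only on `v` and `Y x`, because
`⟨∇_v Y, e_k⟩ = -⟨Y, ∇_v e_k⟩` for the normal fields `e_k`. -/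
theorem starProjection_leviCivita (he : IsOrthonormalFrameOn e U) (hD : D.IsSpannedOn e s U)
    (hx : x ∈ U) (hY : MDiffAt (T% Y) x) (hYD : ∀ᶠ y in 𝓝 x, Y y ∈ D y)
    (v : TangentSpace 𝓘(ℝ, E) x) :
    (D x)ᗮ.starProjection (leviCivita E M Y x v) = normalForm e s x v (Y x) := by
  rw [he.starProjection_orthogonal_eq hD hx, normalForm_apply]
  refine Finset.sum_congr rfl fun k hk => ?_
  congr 1
  rw [real_inner_comm, he.inner_leviCivita_apply hx]
  refine Finset.sum_congr rfl fun i _ => ?_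
  have h0 : (fun y => ⟪Y y, e k y⟫_ℝ) =ᶠ[𝓝 x] fun _ => 0 := by
    filter_upwards [hYD, he.eventually_mem hx] with y hy hyU
      using he.inner_eq_zero_of_mem hD hyU hy hk
  have h1 := leviCivita_metric (he.mdifferentiableAt hx i) hY (he.mdifferentiableAt hx k)
  rw [mvfderiv_congr h0, mvfderiv_const] at h1
  rw [eq_neg_of_add_eq_zero_left h1.symm, ← he.sum_inner_mul_inner hx (Y x), mul_neg,
    Finset.mul_sum, ← Finset.sum_neg_distrib]
  refine Finset.sum_congr rfl fun j _ => ?_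
  rw [he.connCoeff_swap hx i j k, connCoeff, real_inner_comm (e j x), real_inner_comm (e j x)]
  ring

theorem mdifferentiableAt_extendIn (he : IsOrthonormalFrameOn e U) (hD : D.IsSpannedOn e s U)
    (hx : x ∈ U) (v : TangentSpace 𝓘(ℝ, E) x) : MDiffAt (T% (D.extendIn v)) x := by
  have h1 : CMDiffAt ∞ (T% (fun y => ∑ i ∈ s, ⟪e i y, extend E v y⟫_ℝ • e i y)) x :=
    .sum_section fun i _ =>
      (contMDiffAt_inner (he.contMDiffAt i x hx) (contMDiffAt_extend_tangent v)).smul_section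
        (he.contMDiffAt i x hx)
  refine (mdifferentiableAt_of_contMDiffAt h1).congr_of_eventuallyEq ?_
  filter_upwards [he.eventually_mem hx] with y hy
    using congrArg (TotalSpace.mk y) (he.starProjection_eq hD hy (extend E v y))

theorem extendIn_mem (v : TangentSpace 𝓘(ℝ, E) x) (y : M) : D.extendIn v y ∈ D y :=
  Submodule.starProjection_apply_mem _ _

theorem extendIn_apply_self (v : D x) : D.extendIn (v : TangentSpace 𝓘(ℝ, E) x) x = v := by
  rw [Distribution.extendIn, extend_apply_self]
  exact Submodule.starProjection_eq_self_iff.2 v.2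

theorem h_eq (he : IsOrthonormalFrameOn e U) (hD : D.IsSpannedOn e s U) (hx : x ∈ U) (u v : D x) :
    D.h x u v = ((1 / 2 : ℝ) • (normalForm e s x + (normalForm e s x).flip)) u v := by
  have h1 (v : TangentSpace 𝓘(ℝ, E) x) := he.starProjection_leviCivita hD hx
    (he.mdifferentiableAt_extendIn hD hx v) (Filter.Eventually.of_forall (extendIn_mem v))
  rw [Distribution.h, Distribution.secondFundamentalForm, map_add]
  erw [h1, h1]
  rw [extendIn_apply_self, extendIn_apply_self]
  rfl

theorem T_eq (he : IsOrthonormalFrameOn e U) (hD : D.IsSpannedOn e s U) (hx : x ∈ U) (u v : D x) :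
    D.T x u v = ((1 / 2 : ℝ) • (normalForm e s x - (normalForm e s x).flip)) u v := by
  have h1 (v : TangentSpace 𝓘(ℝ, E) x) := he.starProjection_leviCivita hD hx
    (he.mdifferentiableAt_extendIn hD hx v) (Filter.Eventually.of_forall (extendIn_mem v))
  rw [Distribution.T, Distribution.integrabilityTensor, map_sub]
  erw [h1, h1]
  rw [extendIn_apply_self, extendIn_apply_self]
  rfl

theorem H_eq (he : IsOrthonormalFrameOn e U) (hD : D.IsSpannedOn e s U) (hx : x ∈ U) :
    D.H x = ∑ k ∈ sᶜ, (∑ i ∈ s, connCoeff e i i k x) • e k x := by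
  have h1 := sum_bilin_orthonormalBasis (he.orthonormal x hx) s (D x) (hD x hx)
    (stdOrthonormalBasis ℝ (D x)) ((1 / 2 : ℝ) • (normalForm e s x + (normalForm e s x).flip))
  simp only [Distribution.H, he.h_eq hD hx]
  rw [h1]
  have h2 (i : ι) : ((1 / 2 : ℝ) • (normalForm e s x + (normalForm e s x).flip)) (e i x) (e i x) =
      ∑ k ∈ sᶜ, connCoeff e i i k x • e k x := by
    rw [← he.normalForm_frame hx]
    simp only [LinearMap.smul_apply, LinearMap.add_apply, LinearMap.flip_apply]
    rw [← two_smul ℝ, smul_smul]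
    norm_num
  simp only [h2, Finset.sum_smul]
  rw [Finset.sum_comm]

theorem norm_sq_sum_smul (he : IsOrthonormalFrameOn e U) (hx : x ∈ U) (t : Finset ι) (c : ι → ℝ) :
    ‖∑ k ∈ t, c k • e k x‖ ^ 2 = ∑ k ∈ t, c k ^ 2 := by
  rw [← real_inner_self_eq_norm_sq, (he.orthonormal x hx).inner_sum]
  exact Finset.sum_congr rfl fun k _ => by simp [sq]

theorem norm_sq_H (he : IsOrthonormalFrameOn e U) (hD : D.IsSpannedOn e s U) (hx : x ∈ U) :
    ‖D.H x‖ ^ 2 = ∑ k ∈ sᶜ, (∑ i ∈ s, connCoeff e i i k x) ^ 2 := by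
  rw [he.H_eq hD hx, he.norm_sq_sum_smul hx]

theorem normSqh_eq (he : IsOrthonormalFrameOn e U) (hD : D.IsSpannedOn e s U) (hx : x ∈ U) :
    D.normSqh x = ∑ i ∈ s, ∑ j ∈ s, ∑ k ∈ sᶜ,
      ((1 / 2) * (connCoeff e i j k x + connCoeff e j i k x)) ^ 2 := by
  simp only [Distribution.normSqh, he.h_eq hD hx]
  rw [sum_norm_sq_orthonormalBasis (he.orthonormal x hx) s (D x) (hD x hx)]
  refine Finset.sum_congr rfl fun i _ => Finset.sum_congr rfl fun j _ => ?_
  rw [← he.norm_sq_sum_smul hx]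
  simp only [LinearMap.smul_apply, LinearMap.add_apply, LinearMap.flip_apply,
    he.normalForm_frame hx, ← Finset.sum_add_distrib, Finset.smul_sum, ← add_smul, smul_smul]

theorem normSqT_eq (he : IsOrthonormalFrameOn e U) (hD : D.IsSpannedOn e s U) (hx : x ∈ U) :
    D.normSqT x = ∑ i ∈ s, ∑ j ∈ s, ∑ k ∈ sᶜ,
      ((1 / 2) * (connCoeff e i j k x - connCoeff e j i k x)) ^ 2 := by
  simp only [Distribution.normSqT, he.T_eq hD hx]
  rw [sum_norm_sq_orthonormalBasis (he.orthonormal x hx) s (D x) (hD x hx)]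
  refine Finset.sum_congr rfl fun i _ => Finset.sum_congr rfl fun j _ => ?_
  rw [← he.norm_sq_sum_smul hx]
  simp only [LinearMap.smul_apply, LinearMap.sub_apply, LinearMap.flip_apply,
    he.normalForm_frame hx, ← Finset.sum_sub_distrib, Finset.smul_sum, ← sub_smul, smul_smul]

theorem mixedCurvature_eq (he : IsOrthonormalFrameOn e U) (hD : D.IsSpannedOn e s U)
    (hD' : D'.IsSpannedOn e t U) (hx : x ∈ U) :
    mixedCurvature D D' x = ∑ a ∈ s, ∑ b ∈ t, ⟪curvature (e a) (e b) (e a) x, e b x⟫_ℝ := by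
  have h1 (u : TangentSpace 𝓘(ℝ, E) x) := sum_bilin_orthonormalBasis (he.orthonormal x hx) t
    (D' x) (hD' x hx) (stdOrthonormalBasis ℝ (D' x)) (he.curvatureFormRight hx u)
  have h2 (v : TangentSpace 𝓘(ℝ, E) x) := sum_bilin_orthonormalBasis (he.orthonormal x hx) s
    (D x) (hD x hx) (stdOrthonormalBasis ℝ (D x)) (he.curvatureFormLeft hx v)
  simp only [curvatureFormRight, curvatureFormLeft, LinearMap.mk₂_apply] at h1 h2
  simp only [mixedCurvature, h1]
  rw [Finset.sum_comm, Finset.sum_comm (s := s)]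
  refine Finset.sum_congr rfl fun b _ => ?_
  rw [h2]
  refine Finset.sum_congr rfl fun a _ => ?_
  rw [he.curvatureAt_apply hx (he.contMDiffAt a x hx) (he.contMDiffAt b x hx)
    (he.contMDiffAt a x hx)]

/-- The mean curvature vector field of a distribution spanned by some fields of a smooth orthonormal
frame is smooth. -/
theorem contMDiffAt_H (he : IsOrthonormalFrameOn e U) (hD : D.IsSpannedOn e s U) (hx : x ∈ U) :
    CMDiffAt ∞ (T% D.H) x := by
  have h1 : CMDiffAt ∞ (T% (fun y => ∑ k ∈ sᶜ, (∑ i ∈ s, connCoeff e i i k y) • e k y)) x :=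
    .sum_section fun k _ => ContMDiffAt.smul_section
      (ContMDiffAt.sum fun i _ => he.contMDiffAt_connCoeff hx i i k) (he.contMDiffAt k x hx)
  refine h1.congr_of_eventuallyEq ?_
  filter_upwards [he.eventually_mem hx] with y hy
    using congrArg (TotalSpace.mk y) (he.H_eq hD hy)

theorem divergence_H (he : IsOrthonormalFrameOn e U) (hD : D.IsSpannedOn e s U) (hx : x ∈ U) :
    divergence D.H x = ∑ a ∈ s, ∑ b ∈ sᶜ, (mvfderiv 𝓘(ℝ, E) (connCoeff e a a b) x (e b x)
      + connCoeff e a a b x * ∑ i, connCoeff e i b i x) := by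
  rw [he.divergence_eq hx (φ := fun k y => if k ∈ sᶜ then ∑ i ∈ s, connCoeff e i i k y else 0)
    (he.contMDiffAt_H hD hx)]
  · rw [← Finset.sum_subset (Finset.subset_univ sᶜ), Finset.sum_comm]
    · refine Finset.sum_congr rfl fun b hb => ?_
      simp only [if_pos hb, Finset.sum_add_distrib, Finset.sum_mul]
      congr 1
      have h2 : ∀ r : Finset ι, mvfderiv 𝓘(ℝ, E) (fun y => ∑ i ∈ r, connCoeff e i i b y) x (e b x) =
          ∑ i ∈ r, mvfderiv 𝓘(ℝ, E) (connCoeff e i i b) x (e b x) := by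
        intro r
        induction r using Finset.induction_on with
        | empty => simp [mvfderiv_const]
        | insert i r hi ih =>
          simp only [Finset.sum_insert hi]
          rw [← ih, mvfderiv_fun_add ((he.contMDiffAt_connCoeff hx i i b).mdifferentiableAt
            (by simp)) ((ContMDiffAt.sum fun j _ =>
              he.contMDiffAt_connCoeff hx j j b).mdifferentiableAt (by simp))]
          rfl
      exact h2 s
    · intro k _ hk
      simp [hk, mvfderiv_const]
  · intro k
    filter_upwards [he.eventually_mem hx] with y hy
    rw [he.H_eq hD hy, sum_inner]
    simp [inner_smul_left, he.inner_eq hy]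

end IsOrthonormalFrameOn

end Distribution

/-! ### The divergence formula for a pair of complementary distributions -/

section Algebra

variable {ι : Type*} {s t : Finset ι} {Γ : ι → ι → ι → ℝ}

theorem sum_mul_eq_zero_of_antisymm (s : Finset ι) (A B : ι → ι → ℝ) (hA : ∀ i j, A i j = -A j i)
    (hB : ∀ i j, B i j = B j i) : ∑ i ∈ s, ∑ j ∈ s, A i j * B i j = 0 := by
  have h : ∑ i ∈ s, ∑ j ∈ s, A i j * B i j = -∑ i ∈ s, ∑ j ∈ s, A i j * B i j := by
    conv_lhs => rw [Finset.sum_comm]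
    simp only [← Finset.sum_neg_distrib]
    exact Finset.sum_congr rfl fun i _ => Finset.sum_congr rfl fun j _ => by
      rw [hA j i, hB j i, neg_mul]
  linarith

theorem sum_sq_sub_sum_sq (s t : Finset ι) (Γ : ι → ι → ι → ℝ) :
    ∑ i ∈ s, ∑ j ∈ s, ∑ k ∈ t, ((1 / 2) * (Γ i j k + Γ j i k)) ^ 2
      - ∑ i ∈ s, ∑ j ∈ s, ∑ k ∈ t, ((1 / 2) * (Γ i j k - Γ j i k)) ^ 2
      = ∑ i ∈ s, ∑ j ∈ s, ∑ k ∈ t, Γ i j k * Γ j i k := by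
  simp only [← Finset.sum_sub_distrib]
  exact Finset.sum_congr rfl fun i _ => Finset.sum_congr rfl fun j _ =>
    Finset.sum_congr rfl fun k _ => by ring

/-- The part of the curvature terms in which the summation index of the frame runs through `s`. -/
theorem sum_curvature_terms (s t : Finset ι) (hΓ : ∀ i j k, Γ i j k = -Γ i k j) :
    ∑ a ∈ s, ∑ b ∈ t, ∑ c ∈ s, (Γ b a c * Γ a b c + (Γ a b c - Γ b a c) * Γ c a b)
      = -∑ i ∈ s, ∑ j ∈ s, ∑ k ∈ t, Γ i j k * Γ j i k := by
  have h1 (b : ι) : ∑ a ∈ s, ∑ c ∈ s, Γ b a c * (Γ a c b + Γ c a b) = 0 :=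
    sum_mul_eq_zero_of_antisymm s (fun a c => Γ b a c) (fun a c => Γ a c b + Γ c a b)
      (fun a c => hΓ b a c) (fun a c => add_comm _ _)
  have h2 : ∑ a ∈ s, ∑ b ∈ t, ∑ c ∈ s, (Γ b a c * Γ a b c + (Γ a b c - Γ b a c) * Γ c a b) =
      ∑ a ∈ s, ∑ b ∈ t, ∑ c ∈ s, -(Γ b a c * (Γ a c b + Γ c a b))
        + ∑ a ∈ s, ∑ b ∈ t, ∑ c ∈ s, -(Γ a c b * Γ c a b) := by
    simp only [← Finset.sum_add_distrib]
    exact Finset.sum_congr rfl fun a _ => Finset.sum_congr rfl fun b _ =>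
      Finset.sum_congr rfl fun c _ => by rw [hΓ a b c]; ring
  have h3 : ∑ a ∈ s, ∑ b ∈ t, ∑ c ∈ s, -(Γ b a c * (Γ a c b + Γ c a b)) = 0 := by
    rw [Finset.sum_comm]
    simp only [Finset.sum_neg_distrib, h1]
    simp
  rw [h2, h3, zero_add]
  simp only [Finset.sum_neg_distrib]
  congr 1
  exact Finset.sum_congr rfl fun a _ => Finset.sum_comm

theorem sum_mul_trace (s t : Finset ι) (hΓ : ∀ i j k, Γ i j k = -Γ i k j) :
    ∑ a ∈ s, ∑ b ∈ t, Γ a a b * ∑ i ∈ s, Γ i b i = -∑ k ∈ t, (∑ a ∈ s, Γ a a k) ^ 2 := by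
  rw [Finset.sum_comm, ← Finset.sum_neg_distrib]
  refine Finset.sum_congr rfl fun b _ => ?_
  have h : ∑ i ∈ s, Γ i b i = -∑ i ∈ s, Γ i i b := by
    rw [← Finset.sum_neg_distrib]
    exact Finset.sum_congr rfl fun i _ => hΓ i b i
  rw [← Finset.sum_mul, h]
  ring

theorem sum_mul_trace_compl (s t : Finset ι) (hΓ : ∀ i j k, Γ i j k = -Γ i k j) :
    ∑ a ∈ s, ∑ b ∈ t, Γ a a b * ∑ i ∈ t, Γ i b i =
      ∑ a ∈ s, ∑ b ∈ t, ∑ c ∈ t, -(Γ a a c * Γ b b c) := by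
  refine Finset.sum_congr rfl fun a _ => ?_
  simp only [Finset.mul_sum]
  rw [Finset.sum_comm]
  exact Finset.sum_congr rfl fun b _ => Finset.sum_congr rfl fun c _ => by
    rw [hΓ b c b]; ring

/-- The algebraic core of the divergence formula: the quadratic expressions in the connection
coefficients `Γ` on both sides agree. Here `d a b` stands for the derivative of `Γ a a b` along the
`b`-th field of the frame. -/
theorem divergence_algebra [Fintype ι] [DecidableEq ι] (s : Finset ι) (d : ι → ι → ℝ)
    (hΓ : ∀ i j k, Γ i j k = -Γ i k j) :
    ∑ a ∈ s, ∑ b ∈ sᶜ, (d a b + Γ a a b * ∑ i, Γ i b i)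
      + ∑ a ∈ sᶜ, ∑ b ∈ s, (d a b + Γ a a b * ∑ i, Γ i b i)
    = ∑ a ∈ s, ∑ b ∈ sᶜ, (d a b + d b a + ∑ c, (-(Γ a a c * Γ b b c) + Γ b a c * Γ a b c
          + (Γ a b c - Γ b a c) * Γ c a b))
      + (∑ i ∈ s, ∑ j ∈ s, ∑ k ∈ sᶜ, Γ i j k * Γ j i k - ∑ k ∈ sᶜ, (∑ a ∈ s, Γ a a k) ^ 2)
      + (∑ i ∈ sᶜ, ∑ j ∈ sᶜ, ∑ k ∈ s, Γ i j k * Γ j i k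
        - ∑ k ∈ s, (∑ a ∈ sᶜ, Γ a a k) ^ 2) := by
  set t := sᶜ
  have hsplit (f : ι → ℝ) : ∑ i, f i = ∑ i ∈ s, f i + ∑ i ∈ t, f i :=
    (Finset.sum_add_sum_compl s f).symm
  have hd : ∑ a ∈ t, ∑ b ∈ s, d a b = ∑ a ∈ s, ∑ b ∈ t, d b a := Finset.sum_comm
  have h1 := sum_mul_trace s t hΓ
  have h2 := sum_mul_trace_compl s t hΓ
  have h3 := sum_mul_trace t s hΓ
  have h4 := sum_mul_trace_compl t s hΓ
  have h5 := sum_curvature_terms s t hΓ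
  have h6 := sum_curvature_terms t s hΓ
  have h4' : ∑ a ∈ t, ∑ b ∈ s, ∑ c ∈ s, -(Γ a a c * Γ b b c) =
      ∑ a ∈ s, ∑ b ∈ t, ∑ c ∈ s, -(Γ a a c * Γ b b c) := by
    rw [Finset.sum_comm]
    exact Finset.sum_congr rfl fun a _ => Finset.sum_congr rfl fun b _ =>
      Finset.sum_congr rfl fun c _ => by ring
  -- The curvature terms are symmetric in `a` and `b`.
  have h6' : ∑ a ∈ t, ∑ b ∈ s, ∑ c ∈ t, (Γ b a c * Γ a b c + (Γ a b c - Γ b a c) * Γ c a b) =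
      ∑ a ∈ s, ∑ b ∈ t, ∑ c ∈ t, (Γ b a c * Γ a b c + (Γ a b c - Γ b a c) * Γ c a b) := by
    rw [Finset.sum_comm]
    exact Finset.sum_congr rfl fun a _ => Finset.sum_congr rfl fun b _ =>
      Finset.sum_congr rfl fun c _ => by rw [hΓ c b a]; ring
  rw [h4'] at h4
  rw [h6'] at h6
  simp only [hsplit, mul_add, Finset.sum_add_distrib] at h1 h2 h3 h4 h5 h6 ⊢
  rw [hd]
  linarith

end Algebra

section Pair

variable {E : Type*} [NormedAddCommGroup E] [NormedSpace ℝ E] [FiniteDimensional ℝ E]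
  {M : Type*} [TopologicalSpace M] [ChartedSpace E M] [IsManifold 𝓘(ℝ, E) ∞ M]
  [RiemannianBundle (fun x : M => TangentSpace 𝓘(ℝ, E) x)]
  [IsContMDiffRiemannianBundle 𝓘(ℝ, E) ∞ E (fun x : M => TangentSpace 𝓘(ℝ, E) x)]
  {x : M} {ι : Type*} [Fintype ι] [DecidableEq ι]
  {e : ι → Π x : M, TangentSpace 𝓘(ℝ, E) x} {U : Set M} {D D' : Distribution E M} {s : Finset ι}

namespace IsOrthonormalFrameOn

theorem inner_curvature_frame_symm (he : IsOrthonormalFrameOn e U) (hx : x ∈ U) (a b : ι) :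
    ⟪curvature (e a) (e b) (e a) x, e b x⟫_ℝ = ⟪curvature (e b) (e a) (e b) x, e a x⟫_ℝ := by
  rw [he.inner_curvature_swap hx (he.contMDiffAt a x hx) (he.contMDiffAt b x hx)
    (he.contMDiffAt a x hx) (he.contMDiffAt b x hx), curvature_swap, inner_neg_left, neg_neg]

/-- Walczak's formula for the divergence of the sum of the mean curvature vectors of two
complementary orthogonal distributions. -/
theorem divergence_H_add_divergence_H (he : IsOrthonormalFrameOn e U) (hD : D.IsSpannedOn e s U)
    (hD' : D'.IsSpannedOn e sᶜ U) (hx : x ∈ U) :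
    divergence D.H x + divergence D'.H x =
      ∑ a ∈ s, ∑ b ∈ sᶜ, ⟪curvature (e a) (e b) (e a) x, e b x⟫_ℝ
        + (D.normSqh x - ‖D.H x‖ ^ 2 - D.normSqT x)
        + (D'.normSqh x - ‖D'.H x‖ ^ 2 - D'.normSqT x) := by
  have h1 := sum_sq_sub_sum_sq s sᶜ (fun i j k => connCoeff e i j k x)
  have h2 := sum_sq_sub_sum_sq sᶜ s (fun i j k => connCoeff e i j k x)
  have h3 := divergence_algebra s (fun a b => mvfderiv 𝓘(ℝ, E) (connCoeff e a a b) x (e b x))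
    (he.connCoeff_swap hx)
  rw [he.divergence_H hD hx, he.divergence_H hD' hx, he.normSqh_eq hD hx, he.normSqh_eq hD' hx,
    he.normSqT_eq hD hx, he.normSqT_eq hD' hx, he.norm_sq_H hD hx, he.norm_sq_H hD' hx,
    compl_compl]
  simp only [he.inner_curvature_frame hx]
  linarith

end IsOrthonormalFrameOn

end Pair

section Structure

variable {E : Type*} [NormedAddCommGroup E] [NormedSpace ℝ E] [FiniteDimensional ℝ E]
  {M : Type*} [TopologicalSpace M] [ChartedSpace E M] [IsManifold 𝓘(ℝ, E) ∞ M]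
  [RiemannianBundle (fun x : M => TangentSpace 𝓘(ℝ, E) x)]
  [IsContMDiffRiemannianBundle 𝓘(ℝ, E) ∞ E (fun x : M => TangentSpace 𝓘(ℝ, E) x)]
  {X Y : Π x : M, TangentSpace 𝓘(ℝ, E) x} {x : M} {U : Set M} {k : ℕ}

/-! ### Adapted orthonormal frames -/

/-- The Gram-Schmidt process turns linearly independent smooth fields into smooth fields. -/
theorem contMDiffAt_gramSchmidt {n : ℕ} {s : Fin n → Π x : M, TangentSpace 𝓘(ℝ, E) x}
    (hs : ∀ a, CMDiffAt ∞ (T% (s a)) x) (hli : LinearIndependent ℝ fun a => s a x) (a : Fin n) :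
    CMDiffAt ∞ (T% (fun y => gramSchmidt ℝ (fun b => s b y) a)) x := by
  induction a using WellFoundedLT.induction with
  | ind a ih =>
    have h1 : (fun y => gramSchmidt ℝ (fun b => s b y) a) = s a - fun y => ∑ i ∈ Finset.Iio a,
        (⟪gramSchmidt ℝ (fun b => s b y) i, s a y⟫_ℝ
          / ⟪gramSchmidt ℝ (fun b => s b y) i, gramSchmidt ℝ (fun b => s b y) i⟫_ℝ) •
          gramSchmidt ℝ (fun b => s b y) i := by
      funext y
      have h2 := gramSchmidt_def'' ℝ (fun b => s b y) a
      simp only [real_inner_self_eq_norm_sq]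
      exact eq_sub_of_add_eq h2.symm
    suffices h : CMDiffAt ∞ (T% (s a - fun y => ∑ i ∈ Finset.Iio a,
        (⟪gramSchmidt ℝ (fun b => s b y) i, s a y⟫_ℝ
          / ⟪gramSchmidt ℝ (fun b => s b y) i, gramSchmidt ℝ (fun b => s b y) i⟫_ℝ) •
          gramSchmidt ℝ (fun b => s b y) i)) x by
      rw [← h1] at h
      exact h
    refine (hs a).sub_section (.sum_section fun i hi => ?_)
    have hi' := ih i (Finset.mem_Iio.1 hi)
    exact ContMDiffAt.smul_section ((contMDiffAt_inner hi' (hs a)).div₀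
      (contMDiffAt_inner hi' hi') (inner_self_ne_zero.2 (gramSchmidt_ne_zero i hli))) hi'

theorem contMDiffAt_gramSchmidtNormed {n : ℕ} {s : Fin n → Π x : M, TangentSpace 𝓘(ℝ, E) x}
    (hs : ∀ a, CMDiffAt ∞ (T% (s a)) x) (hli : LinearIndependent ℝ fun a => s a x) (a : Fin n) :
    CMDiffAt ∞ (T% (fun y => gramSchmidtNormed ℝ (fun b => s b y) a)) x := by
  have hg := contMDiffAt_gramSchmidt hs hli a
  have hne := gramSchmidt_ne_zero a hli
  have hn : CMDiffAt ∞ (fun y => ‖gramSchmidt ℝ (fun b => s b y) a‖) x := by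
    simp only [norm_eq_sqrt_real_inner]
    exact (Real.contDiffAt_sqrt (inner_self_ne_zero.2 hne)).contMDiffAt.comp x
      (contMDiffAt_inner hg hg)
  exact ContMDiffAt.smul_section (hn.inv₀ (norm_ne_zero_iff.2 hne)) hg

namespace RiemannianAlmostProduct

/-- The indices of the fields of an adapted frame that span `D_q`. -/
def frameIndices (P : RiemannianAlmostProduct E M k) (q : Finset (Fin k)) :
    Finset (Σ i, Fin (P.rank i)) :=
  Finset.univ.filter fun j => j.1 ∈ q

theorem mem_frameIndices (P : RiemannianAlmostProduct E M k) (q : Finset (Fin k))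
    (j : Σ i, Fin (P.rank i)) : j ∈ P.frameIndices q ↔ j.1 ∈ q := by
  simp [frameIndices]

theorem frameIndices_compl (P : RiemannianAlmostProduct E M k) (q : Finset (Fin k)) :
    P.frameIndices qᶜ = (P.frameIndices q)ᶜ := by
  ext j
  simp [mem_frameIndices]

theorem sumOver_singleton (P : RiemannianAlmostProduct E M k) (i : Fin k) :
    P.sumOver {i} = P.D i := by
  funext x
  simp [sumOver]

/-- Near every point there is a smooth orthonormal frame adapted to all the distributions. -/
theorem exists_frame (P : RiemannianAlmostProduct E M k) (x : M) :
    ∃ (e : (Σ i, Fin (P.rank i)) → Π x : M, TangentSpace 𝓘(ℝ, E) x) (U : Set M), x ∈ U ∧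
      IsOrthonormalFrameOn e U ∧ ∀ q, (P.sumOver q).IsSpannedOn e (P.frameIndices q) U := by
  choose V hVo hxV s hs hsp using fun i => P.isSmoothOfRank i x
  have hspan (i : Fin k) {y : M} (hy : y ∈ ⋂ i, V i) :
      Submodule.span ℝ (Set.range (gramSchmidtNormed ℝ fun b => s i b y)) = P.D i y := by
    rw [span_gramSchmidtNormed_range, span_gramSchmidt]
    exact (hsp i y (Set.mem_iInter.1 hy i)).2
  have hmem (j : Σ i, Fin (P.rank i)) {y : M} (hy : y ∈ ⋂ i, V i) :
      gramSchmidtNormed ℝ (fun b => s j.1 b y) j.2 ∈ P.D j.1 y := by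
    rw [← hspan j.1 hy]
    exact Submodule.subset_span ⟨j.2, rfl⟩
  have hon (i : Fin k) {y : M} (hy : y ∈ ⋂ i, V i) :
      Orthonormal ℝ (gramSchmidtNormed ℝ fun b => s i b y) :=
    gramSchmidtNormed_orthonormal (hsp i y (Set.mem_iInter.1 hy i)).1
  have hortho {y : M} (hy : y ∈ ⋂ i, V i) :
      Orthonormal ℝ fun j : Σ i, Fin (P.rank i) =>
        gramSchmidtNormed ℝ (fun b => s j.1 b y) j.2 := by
    refine ⟨fun j => (hon j.1 hy).1 j.2, ?_⟩
    rintro ⟨i, a⟩ ⟨i', a'⟩ hne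
    by_cases hii : i = i'
    · subst hii
      exact (hon i hy).2 fun h => hne (congrArg (Sigma.mk i) h)
    · exact Submodule.isOrtho_iff_inner_eq.1 (P.isOrtho i i' hii y) _ (hmem ⟨i, a⟩ hy) _
        (hmem ⟨i', a'⟩ hy)
  refine ⟨fun j y => gramSchmidtNormed ℝ (fun b => s j.1 b y) j.2, ⋂ i, V i,
    Set.mem_iInter.2 hxV, ⟨isOpen_iInter_of_finite hVo, fun j y hy => ?_, fun y hy => hortho hy,
      fun y hy => ?_⟩, fun q y hy => le_antisymm ?_ ?_⟩
  · have hy' := Set.mem_iInter.1 hy j.1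
    exact contMDiffAt_gramSchmidtNormed
      (fun a => (hs j.1 a).contMDiffAt ((hVo j.1).mem_nhds hy')) (hsp j.1 y hy').1 j.2
  · refine ((hortho hy).linearIndependent.span_eq_top_of_card_eq_finrank' ?_).ge
    rw [Fintype.card_sigma]
    simp only [Fintype.card_fin]
    exact P.sum_rank
  · refine iSup₂_le fun i hi => ?_
    rw [← hspan i hy]
    refine Submodule.span_mono ?_
    rintro _ ⟨a, rfl⟩
    exact ⟨⟨i, a⟩, (P.mem_frameIndices q _).2 hi, rfl⟩
  · rw [Submodule.span_le]
    rintro _ ⟨j, hj, rfl⟩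
    exact (le_iSup₂_of_le (f := fun i (_ : i ∈ q) => P.D i y) j.1 ((P.mem_frameIndices q j).1 hj)
      le_rfl) (hmem j hy)

end RiemannianAlmostProduct

/-! ### Summation over the distributions -/

theorem sum_combinations_one {A : Type*} [AddCommMonoid A] (f : Finset (Fin k) → A) :
    ∑ q ∈ combinations 1 k, f q = ∑ i, f {i} := by
  rw [combinations, Finset.powersetCard_one, Finset.sum_map]
  rfl

theorem sum_combinations_pred {A : Type*} [AddCommMonoid A] (hk : 1 ≤ k)
    (f : Finset (Fin k) → A) : ∑ q ∈ combinations (k - 1) k, f q = ∑ i, f {i}ᶜ := by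
  symm
  refine Finset.sum_bij (fun i _ => {i}ᶜ) (fun i _ => ?_) (fun i _ j _ h => ?_) (fun q hq => ?_)
    fun i _ => rfl
  · simp [combinations, Finset.mem_powersetCard, Finset.card_compl]
  · exact Finset.singleton_injective (compl_injective h)
  · rw [combinations, Finset.mem_powersetCard] at hq
    have h1 : qᶜ.card = 1 := by
      rw [Finset.card_compl, hq.2, Fintype.card_fin]
      omega
    obtain ⟨i, hi⟩ := Finset.card_eq_one.1 h1
    exact ⟨i, Finset.mem_univ i, by rw [← hi, compl_compl]⟩

theorem sum_sum_erase_eq_two_mul (κ : Fin k → Fin k → ℝ) (hκ : ∀ i j, κ i j = κ j i) :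
    ∑ i, ∑ j ∈ Finset.univ.erase i, κ i j =
      2 * ∑ i, ∑ j ∈ Finset.univ.filter (fun j => i < j), κ i j := by
  have h1 (i : Fin k) : ∑ j ∈ Finset.univ.erase i, κ i j =
      ∑ j ∈ Finset.univ.filter (fun j => i < j), κ i j
        + ∑ j ∈ Finset.univ.filter (fun j => j < i), κ i j := by
    rw [← Finset.sum_union]
    · congr 1
      ext j
      simp only [Finset.mem_erase, Finset.mem_univ, and_true, Finset.mem_union, Finset.mem_filter,
        true_and]
      rw [ne_comm]
      exact lt_or_lt_iff_ne.symm
    · rw [Finset.disjoint_filter]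
      exact fun j _ h => h.asymm
  have h2 : ∑ i, ∑ j ∈ Finset.univ.filter (fun j => j < i), κ i j =
      ∑ i, ∑ j ∈ Finset.univ.filter (fun j => i < j), κ i j := by
    simp only [Finset.sum_filter]
    rw [Finset.sum_comm]
    exact Finset.sum_congr rfl fun i _ => Finset.sum_congr rfl fun j _ => by rw [hκ j i]
  simp only [h1, Finset.sum_add_distrib, h2]
  ring

theorem divergence_add (hX : MDiffAt (T% X) x) (hY : MDiffAt (T% Y) x) :
    divergence (X + Y) x = divergence X x + divergence Y x := by
  rw [divergence, leviCivita_add hX hY]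
  exact map_add (LinearMap.trace ℝ (TangentSpace 𝓘(ℝ, E) x)) _ _

theorem divergence_sum {α : Type*} [Fintype α] {F : α → Π x : M, TangentSpace 𝓘(ℝ, E) x}
    (hF : ∀ i, MDiffAt (T% (F i)) x) :
    divergence (fun y => ∑ i, F i y) x = ∑ i, divergence (F i) x := by
  classical
  have h : ∀ s : Finset α,
      divergence (fun y => ∑ i ∈ s, F i y) x = ∑ i ∈ s, divergence (F i) x := by
    intro s
    induction s using Finset.induction_on with
    | empty =>
      have h0 : leviCivita E M (fun y => 0) x = 0 :=
        (leviCivita E M).isCovariantDerivativeOnUniv.zero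
      simp only [Finset.sum_empty]
      rw [divergence]
      erw [h0]
      exact map_zero (LinearMap.trace ℝ (TangentSpace 𝓘(ℝ, E) x))
    | insert i s hi ih =>
      simp only [Finset.sum_insert hi]
      rw [← ih]
      exact divergence_add (hF i) (.sum_section fun j _ => hF j)
  exact h Finset.univ

namespace RiemannianAlmostProduct

theorem contMDiffAt_H_sumOver (P : RiemannianAlmostProduct E M k) (q : Finset (Fin k)) (x : M) :
    CMDiffAt ∞ (T% (P.sumOver q).H) x := by
  obtain ⟨e, U, hx, he, hD⟩ := P.exists_frame x
  exact he.contMDiffAt_H (hD q) hx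

/-- Summing the curvatures between `D_i` and its orthogonal complement over all `i` counts every
pair of distributions twice. -/
theorem sum_curvature_eq (P : RiemannianAlmostProduct E M k)
    {e : (Σ i, Fin (P.rank i)) → Π x : M, TangentSpace 𝓘(ℝ, E) x}
    (he : IsOrthonormalFrameOn e U) (hx : x ∈ U)
    (hD : ∀ q, (P.sumOver q).IsSpannedOn e (P.frameIndices q) U) :
    ∑ i, ∑ a ∈ P.frameIndices {i}, ∑ b ∈ (P.frameIndices {i})ᶜ,
      ⟪curvature (e a) (e b) (e a) x, e b x⟫_ℝ = 2 * P.mixedScalarCurvature x := by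
  have h1 (i j : Fin k) : mixedCurvature (P.D i) (P.D j) x =
      ∑ a ∈ P.frameIndices {i}, ∑ b ∈ P.frameIndices {j},
        ⟪curvature (e a) (e b) (e a) x, e b x⟫_ℝ := by
    have hi := hD {i}
    have hj := hD {j}
    rw [sumOver_singleton] at hi hj
    exact he.mixedCurvature_eq hi hj hx
  rw [mixedScalarCurvature, ← sum_sum_erase_eq_two_mul]
  · refine Finset.sum_congr rfl fun i _ => ?_
    simp only [h1]
    rw [Finset.sum_comm (s := Finset.univ.erase i)]
    refine Finset.sum_congr rfl fun a _ => ?_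
    rw [← Finset.sum_fiberwise_of_maps_to (s := (P.frameIndices {i})ᶜ) (t := Finset.univ.erase i)
      (g := Sigma.fst)]
    · refine Finset.sum_congr rfl fun j hj => Finset.sum_congr ?_ fun _ _ => rfl
      ext b
      have hj' := Finset.ne_of_mem_erase hj
      simp only [Finset.mem_filter, Finset.mem_compl, mem_frameIndices, Finset.mem_singleton]
      exact ⟨fun h => h.2, fun h => ⟨h ▸ hj', h⟩⟩
    · intro b hb
      simpa [mem_frameIndices] using hb
  · intro i j
    rw [h1, h1, Finset.sum_comm]
    exact Finset.sum_congr rfl fun b _ => Finset.sum_congr rfl fun a _ =>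
      he.inner_curvature_frame_symm hx a b

end RiemannianAlmostProduct

end Structure

end AlmostProduct

theorem theorem1 {E : Type*} [NormedAddCommGroup E] [NormedSpace ℝ E] [FiniteDimensional ℝ E]
    {M : Type*} [TopologicalSpace M] [ChartedSpace E M] [IsManifold 𝓘(ℝ, E) ∞ M]
    [RiemannianBundle (fun x : M => TangentSpace 𝓘(ℝ, E) x)]
    [IsContMDiffRiemannianBundle 𝓘(ℝ, E) ∞ E (fun x : M => TangentSpace 𝓘(ℝ, E) x)]
    (k : ℕ) (hk : 2 ≤ k) (P : AlmostProduct.RiemannianAlmostProduct E M k)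
    (X : Π x : M, TangentSpace 𝓘(ℝ, E) x)
    (hX : ∀ x, X x = (∑ q ∈ AlmostProduct.combinations 1 k, (P.sumOver q).H x)
      + ∑ q ∈ AlmostProduct.combinations (k - 1) k, (P.sumOver q).H x) :
    CMDiff ∞ (T% X) ∧
    ∀ x : M, AlmostProduct.divergence X x = 2 * P.mixedScalarCurvature x
      + ((∑ q ∈ AlmostProduct.combinations 1 k,
          ((P.sumOver q).normSqh x - ‖(P.sumOver q).H x‖ ^ 2 - (P.sumOver q).normSqT x))
        + ∑ q ∈ AlmostProduct.combinations (k - 1) k,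
          ((P.sumOver q).normSqh x - ‖(P.sumOver q).H x‖ ^ 2 - (P.sumOver q).normSqT x)) := by
  have hk1 : 1 ≤ k := by omega
  have hsum : X = (fun y => ∑ i, (P.sumOver {i}).H y) + fun y => ∑ i, (P.sumOver {i}ᶜ).H y := by
    funext y
    rw [hX y, AlmostProduct.sum_combinations_one, AlmostProduct.sum_combinations_pred hk1]
    rfl
  have hsmooth (f : Fin k → Finset (Fin k)) (x : M) :
      CMDiffAt ∞ (T% (fun y => ∑ i, (P.sumOver (f i)).H y)) x :=
    .sum_section fun i _ => P.contMDiffAt_H_sumOver (f i) x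
  have hdiv (f : Fin k → Finset (Fin k)) (x : M) :
      AlmostProduct.divergence (fun y => ∑ i, (P.sumOver (f i)).H y) x =
        ∑ i, AlmostProduct.divergence (P.sumOver (f i)).H x :=
    AlmostProduct.divergence_sum fun i =>
      AlmostProduct.mdifferentiableAt_of_contMDiffAt (P.contMDiffAt_H_sumOver (f i) x)
  rw [hsum]
  refine ⟨fun x => (hsmooth _ x).add_section (hsmooth _ x), fun x => ?_⟩
  obtain ⟨e, U, hx, he, hD⟩ := P.exists_frame x
  rw [AlmostProduct.divergence_add
    (AlmostProduct.mdifferentiableAt_of_contMDiffAt (hsmooth _ x))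
    (AlmostProduct.mdifferentiableAt_of_contMDiffAt (hsmooth _ x)), hdiv, hdiv,
    AlmostProduct.sum_combinations_one, AlmostProduct.sum_combinations_pred hk1,
    ← P.sum_curvature_eq he hx hD, ← Finset.sum_add_distrib, ← Finset.sum_add_distrib,
    ← Finset.sum_add_distrib]
  refine Finset.sum_congr rfl fun i _ => ?_
  have hc : (P.sumOver {i}ᶜ).IsSpannedOn e (P.frameIndices {i})ᶜ U :=
    P.frameIndices_compl {i} ▸ hD {i}ᶜ
  rw [he.divergence_H_add_divergence_H (hD {i}) hc hx, add_assoc]
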